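/- Let $\mathfrak g$ be a finite-dimensional simple Lie algebra over $\mathbf C$ with a nondegenerate symmetric invariant bilinear form $(\cdot\mid\cdot)$. For $i=1,2$ let $f_i\in\mathfrak g$ be nilpotent, $\chi_i=(f_i\mid\cdot)$, and let $\Gamma^i:\mathfrak g=\bigoplus_{j\in\mathbf Z}\mathfrak g^{(i)}_j$ be a good grading for $f_i$, i.e. a Lie algebra grading such that $f_i\in\mathfrak g^{(i)}_{-2}$ and $\operatorname{ad}(f_i):\mathfrak g^{(i)}_j\to\mathfrak g^{(i)}_{j-2}$ is injective for $j\ge 1$ and surjective for $j\le 1$. Let $q_i\in\mathfrak g$ be the element with $\mathfrak g^{(i)}_j=\{x : [q_i,x]=jx\}$, and assume that $q_1,q_2$ lie in a common Cartan subalgebra $\mathfrak h$. Let $\mathfrak m_i=\mathfrak l_i\oplus\bigoplus_{j\ge 2}\mathfrak g^{(i)}_j$, where $\mathfrak l_i\subseteq\mathfrak g^{(i)}_1$ is Lagrangian for the form $\chi_i([\cdot,\cdot])$. Assume that 1. $\mathfrak m_2=\mathfrak m_1\oplus\mathfrak m_0$, where $\mathfrak m_0$ is an $\mathfrak h$-stable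 Lie subalgebra of $\mathfrak m_2$ and $\mathfrak m_1$ is an ideal of $\mathfrak m_2$; 2. $f_2-f_1\in\mathfrak g^{(1)}_0$ and $\mathfrak m_0\subseteq\mathfrak g^{(1)}_0$; 3. $[q_2-q_1,f_1]=0$. Let $\widehat I_i$ be the left ideal of $\mathcal U(\mathfrak g)$ generated by the $y-\chi_i(y)$, $y\in\mathfrak m_i$, put $Q_i=\mathcal U(\mathfrak g)/\widehat I_i$, and let $\mathcal U(\mathfrak g,f_i)=Q_i^{\operatorname{ad}(\mathfrak m_i)}$ be the finite W-algebra, with product $(X \bmod \widehat I_i)(Y\bmod \widehat I_i)=XY\bmod\widehat I_i$. Let $\mathsf W(\mathfrak g,f_i,\mathfrak m_i)$ be the category of finitely generated $\mathcal U(\mathfrak g)$-modules on which $y-\chi_i(y)$ acts locally nilpotently for every $y\in\mathfrak m_i$, and put $\mathrm{Whi}_i(V)=\{v\in V : yv=\chi_i(y)v\ \ \forall y\in\mathfrak m_i\}$ and $\mathrm{Ind}_i(W)=Q_i\otimes_{\mathcal U(\mathfrak g,f_i)}W$. Then $y\mapsto y\bmod\widehat I_1$ maps $\mathfrak m_0$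 to $\mathcal U(\mathfrak g,f_1)$. Let $\widehat I_0$ be the left ideal of $\mathcal U(\mathfrak g,f_1)$ generated by the $(y-\chi_2(y))\bmod\widehat I_1$, $y\in\mathfrak m_0$, put $Q_0=\mathcal U(\mathfrak g,f_1)/\widehat I_0$ and $\mathcal U_0=Q_0^{\operatorname{ad}(\mathfrak m_0)}$ (an algebra for the product induced by $\mathcal U(\mathfrak g,f_1)$); then $(X\bmod\widehat I_1)\bmod\widehat I_0\mapsto X\bmod\widehat I_2$ is a well-defined algebra isomorphism $\mathcal U_0\cong\mathcal U(\mathfrak g,f_2)$. Let $\mathsf W_0$ be the category of finitely generated $\mathcal U(\mathfrak g,f_1)$-modules on which $y-\chi_2(y)$ acts locally nilpotently for every $y\in\mathfrak m_0$, and put $\mathrm{Whi}_0(V)=\{v\in V : yv=\chi_2(y)v\ \ \forall y\in\mathfrak m_0\}$ and $\mathrm{Ind}_0(W)=Q_0\otimes_{\mathcal U_0}W$, where $\mathcal U_0$-modules are identified with $\mathcal U(\mathfrak g,f_2)$-modules through this isomorphism. Then: (a) $\mathrm{Whi}_0$ and $\mathrm{Ind}_0$ are mutually inverse equivalences between $\mathsf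 W_0$ and the category of finitely generated $\mathcal U(\mathfrak g,f_2)$-modules. (b) $\mathsf W(\mathfrak g,f_2,\mathfrak m_2)\subseteq\mathsf W(\mathfrak g,f_1,\mathfrak m_1)$, and $\mathrm{Whi}_1$ and $\mathrm{Ind}_1$ restrict to mutually inverse equivalences between $\mathsf W(\mathfrak g,f_2,\mathfrak m_2)$ and $\mathsf W_0$. (c) On $\mathsf W(\mathfrak g,f_2,\mathfrak m_2)$ one has $\mathrm{Whi}_2=\mathrm{Whi}_0\circ\mathrm{Whi}_1$, as functors to $\mathcal U(\mathfrak g,f_2)$-modules. -/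

import Mathlib

/-!
For a good algebra `m` the twisted elements `x - χ(x)`, `x` running over a homogeneous basis of `m`,
together with homogeneous elements dual to this basis for the pairing `χ ⁅a, b⁆`, satisfy the
Heisenberg relations up to terms of lower Kazhdan degree. The Poincaré lemma for the Weyl algebra,
corrected degree by degree, then shows that a vector of a Whittaker module which is Whittaker modulo
a submodule `P` is the sum of a Whittaker vector and an element of `P`. As `m` acts nilpotently on
`g`, every nonzero Whittaker module also has a nonzero Whittaker vector, so `Q` is a projective
generator of the category of Whittaker modules and `Whi`, `Ind` are inverse equivalences.

In the second stage the elements `y - χ₂(y)`, `y ∈ m₂`, normalize the left ideal of the first stage,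
because `χ₁ = χ₂` on the ideal `m₁` of `m₂`. They act on `Whi₁ V` through `m₀`, and the Whittaker
vectors of `V` for `m₂` are those of `Whi₁ V` for `m₀`. Hence the equivalence of the first stage
carries the generation properties of `Q₂` over to `Q₀`.
-/

open CategoryTheory
open scoped TensorProduct

universe u

noncomputable section

namespace Stages

section Reduction

/-- The twisted elements `φ(y) - χ(y)`, `y ∈ L`. -/
def twisted {k A L : Type*} [CommRing k] [Ring A] [Algebra k A] (φ : L → A) (χ : L → k) :
    Set A :=
  Set.range fun y => φ y - algebraMap k A (χ y)

variable {A : Type u} [Ring A]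

/-- The left `A`-module `Q = A / A T`. -/
abbrev Q (T : Set A) : Type u := A ⧸ (Ideal.span T : Ideal A)

theorem mul_mem_span {T : Set A} {X : A} (hX : ∀ t ∈ T, ⁅t, X⁆ ∈ Ideal.span T) {a : A}
    (ha : a ∈ Ideal.span T) : a * X ∈ Ideal.span T := by
  induction ha using Submodule.span_induction with
  | mem t ht =>
    have h := add_mem (hX t ht) ((Ideal.span T).mul_mem_left X (Ideal.subset_span ht))
    rwa [Ring.lie_def, sub_add_cancel] at h
  | zero => simp
  | add x y _ _ hx hy => rw [add_mul]; exact add_mem hx hy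
  | smul c x _ hx => rw [smul_eq_mul, mul_assoc]; exact (Ideal.span T).mul_mem_left c hx

/-- All `X ∈ A` whose class in `Q = A / A T` is `ad(T)`-invariant; they form a subalgebra. -/
def normalizer (k : Type*) [CommRing k] [Algebra k A] (T : Set A) : Subalgebra k A where
  carrier := {X | ∀ t ∈ T, ⁅t, X⁆ ∈ Ideal.span T}
  mul_mem' := by
    intro X Y hX hY t ht
    have h : ⁅t, X * Y⁆ = ⁅t, X⁆ * Y + X * ⁅t, Y⁆ := by
      simp only [Ring.lie_def]; noncomm_ring
    rw [h]
    exact add_mem (mul_mem_span hY (hX t ht)) ((Ideal.span T).mul_mem_left X (hY t ht))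
  add_mem' := by
    intro X Y hX hY t ht
    have h : ⁅t, X + Y⁆ = ⁅t, X⁆ + ⁅t, Y⁆ := by
      simp only [Ring.lie_def]; noncomm_ring
    rw [h]
    exact add_mem (hX t ht) (hY t ht)
  algebraMap_mem' := by
    intro c t _
    rw [Ring.lie_def, Algebra.commutes, sub_self]
    exact zero_mem _

/-- The ideal of those elements of the normalizer whose class in `Q` is zero. -/
def redIdeal (k : Type*) [CommRing k] [Algebra k A] (T : Set A) : Ideal (normalizer k T) :=
  (Ideal.span T).comap (normalizer k T).subtype

instance (k : Type*) [CommRing k] [Algebra k A] (T : Set A) : (redIdeal k T).IsTwoSided :=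
  ⟨fun {a} b ha => mul_mem_span (X := b.1) b.2 (a := a.1) ha⟩

/-- The reduction `(A / A T)^{ad T}` of `A`: the classes modulo `A T` of the elements of the
normalizer, with the product `(X mod A T) (Y mod A T) = X Y mod A T`. -/
def Reduction (k : Type*) [CommRing k] [Algebra k A] (T : Set A) : Type u :=
  normalizer k T ⧸ redIdeal k T

instance (k : Type*) [CommRing k] [Algebra k A] (T : Set A) : Ring (Reduction k T) :=
  inferInstanceAs (Ring (normalizer k T ⧸ redIdeal k T))

instance (k : Type*) [CommRing k] [Algebra k A] (T : Set A) : Algebra k (Reduction k T) :=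
  inferInstanceAs (Algebra k (normalizer k T ⧸ redIdeal k T))

variable (k : Type*) [CommRing k] [Algebra k A] (T : Set A)

/-- The class `X mod A T` in the reduction, for `X` in the normalizer. -/
def cls (X : A) (hX : X ∈ normalizer k T) : Reduction k T :=
  Ideal.Quotient.mk (redIdeal k T) ⟨X, hX⟩

/-- Right multiplication on `Q` by an element of the normalizer. -/
def rightMul (X : normalizer k T) : Q T →ₗ[A] Q T :=
  Submodule.mapQ _ _ (LinearMap.toSpanSingleton A A X.1)
    fun _ ha => mul_mem_span (X := X.1) X.2 ha

theorem rightMul_mk (X : normalizer k T) (a : A) :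
    rightMul k T X (Submodule.Quotient.mk a) = Submodule.Quotient.mk (a * X.1) :=
  rfl

/-- The right action of the reduction on `Q`, `(a mod A T) · (X mod A T) = a X mod A T`. It
commutes with the left action of `A`, so `Q` is a bimodule. -/
def rightAction : Reduction k T →+* (Module.End A (Q T))ᵐᵒᵖ :=
  Ideal.Quotient.lift (redIdeal k T)
    { toFun := fun X => MulOpposite.op (rightMul k T X)
      map_one' := by
        apply MulOpposite.unop_injective
        refine LinearMap.ext fun q => ?_
        obtain ⟨a, rfl⟩ := Submodule.Quotient.mk_surjective _ q
        exact congrArg Submodule.Quotient.mk (mul_one a)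
      map_zero' := by
        apply MulOpposite.unop_injective
        refine LinearMap.ext fun q => ?_
        obtain ⟨a, rfl⟩ := Submodule.Quotient.mk_surjective _ q
        exact congrArg Submodule.Quotient.mk (mul_zero a)
      map_mul' := fun X Y => by
        apply MulOpposite.unop_injective
        refine LinearMap.ext fun q => ?_
        obtain ⟨a, rfl⟩ := Submodule.Quotient.mk_surjective _ q
        exact congrArg Submodule.Quotient.mk (mul_assoc a X.1 Y.1).symm
      map_add' := fun X Y => by
        apply MulOpposite.unop_injective
        refine LinearMap.ext fun q => ?_
        obtain ⟨a, rfl⟩ := Submodule.Quotient.mk_surjective _ q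
        exact congrArg Submodule.Quotient.mk (mul_add a X.1 Y.1) }
    (fun X hX => by
      apply MulOpposite.unop_injective
      refine LinearMap.ext fun q => ?_
      obtain ⟨a, rfl⟩ := Submodule.Quotient.mk_surjective _ q
      exact (Submodule.Quotient.mk_eq_zero _).2 ((Ideal.span T).mul_mem_left a hX))

/-! ### The functor `Whi` -/

/-- The vectors of `V` that are killed by `T`. For `T` the set of `y - χ(y)`, these are the
`v` with `y v = χ(y) v` for all `y`. -/
def whi (V : Type*) [AddCommGroup V] [Module A V] : AddSubgroup V where
  carrier := {v | ∀ t ∈ T, t • v = 0}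
  zero_mem' := fun t _ => smul_zero t
  add_mem' := fun {v w} hv hw t ht => by rw [smul_add, hv t ht, hw t ht, add_zero]
  neg_mem' := fun {v} hv t ht => by rw [smul_neg, hv t ht, neg_zero]

variable {T} in
theorem smul_eq_zero_of_mem_span {V : Type*} [AddCommGroup V] [Module A V] {a : A}
    (ha : a ∈ Ideal.span T) (v : whi T V) : a • (v : V) = 0 := by
  induction ha using Submodule.span_induction with
  | mem t ht => exact v.2 t ht
  | zero => exact zero_smul A _
  | add x y _ _ hx hy => rw [add_smul, hx, hy, add_zero]
  | smul c x _ hx => rw [smul_assoc, hx, smul_zero]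

/-- The normalizer acts on the vectors killed by `T`. -/
def whiEnd (V : Type*) [AddCommGroup V] [Module A V] :
    normalizer k T →+* AddMonoid.End (whi T V) where
  toFun X :=
    { toFun := fun v => ⟨X.1 • (v : V), fun t ht => by
        have h := smul_eq_zero_of_mem_span (X.2 t ht) v
        rwa [Ring.lie_def, sub_smul, mul_smul, mul_smul, v.2 t ht, smul_zero, sub_zero] at h⟩
      map_zero' := Subtype.ext (smul_zero _)
      map_add' := fun v w => Subtype.ext (smul_add _ _ _) }
  map_one' := by ext v; exact one_smul A (v : V)
  map_mul' X Y := by ext v; exact mul_smul X.1 Y.1 (v : V)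
  map_zero' := by ext v; exact zero_smul A (v : V)
  map_add' X Y := by ext v; exact add_smul X.1 Y.1 (v : V)

/-- The reduction acts on the vectors killed by `T` by `(X mod A T) · v = X v`. -/
instance whiModule (V : Type*) [AddCommGroup V] [Module A V] :
    Module (Reduction k T) (whi T V) :=
  Module.compHom (whi T V) (Ideal.Quotient.lift (redIdeal k T) (whiEnd k T V)
    (fun X hX => by
      ext v
      exact smul_eq_zero_of_mem_span (a := X.1) hX v))

theorem cls_smul_coe (V : Type*) [AddCommGroup V] [Module A V] (X : A)
    (hX : X ∈ normalizer k T) (v : whi T V) : ((cls k T X hX • v : whi T V) : V) = X • (v : V) :=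
  rfl

/-- A homomorphism of `A`-modules restricts to the vectors killed by `T`. -/
def whiMap {V W : Type*} [AddCommGroup V] [Module A V] [AddCommGroup W] [Module A W]
    (f : V →ₗ[A] W) : whi T V →ₗ[Reduction k T] whi T W where
  toFun v := ⟨f v, fun t ht => by rw [← map_smul, v.2 t ht, map_zero]⟩
  map_add' v w := Subtype.ext (map_add f _ _)
  map_smul' r v := by
    obtain ⟨X, rfl⟩ := Ideal.Quotient.mk_surjective r
    exact Subtype.ext (map_smul f X.1 (v : V))

/-- The functor `V ↦ Whi(V)` from `A`-modules to modules over the reduction. -/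
def Whi : ModuleCat.{u} A ⥤ ModuleCat.{u} (Reduction k T) where
  obj V := ModuleCat.of _ (whi T V)
  map f := ModuleCat.ofHom (whiMap k T f.hom)

/-! ### The functor `Ind` -/

/-- The relations `(q · r) ⊗ w = q ⊗ (r · w)` in `Q ⊗ W`. -/
def indRel (W : Type*) [AddCommGroup W] [Module (Reduction k T) W] :
    Submodule A (Q T ⊗[ℤ] W) :=
  Submodule.span A {z | ∃ (q : Q T) (r : Reduction k T) (w : W),
    z = ((rightAction k T r).unop q) ⊗ₜ[ℤ] w - q ⊗ₜ[ℤ] (r • w)}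

/-- The left `A`-module `Q ⊗ W`, with the tensor product over the reduction. -/
abbrev ind (W : Type*) [AddCommGroup W] [Module (Reduction k T) W] : Type _ :=
  (Q T ⊗[ℤ] W) ⧸ indRel k T W

/-- The homomorphism `q ⊗ w ↦ q ⊗ f w`. -/
def indMap {V W : Type*} [AddCommGroup V] [Module (Reduction k T) V] [AddCommGroup W]
    [Module (Reduction k T) W] (f : V →ₗ[Reduction k T] W) : ind k T V →ₗ[A] ind k T W :=
  Submodule.mapQ _ _
    (TensorProduct.AlgebraTensorModule.map (LinearMap.id : Q T →ₗ[A] Q T)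
      f.toAddMonoidHom.toIntLinearMap)
    (by
      rw [indRel, Submodule.span_le]
      rintro _ ⟨q, r, w, rfl⟩
      refine Submodule.subset_span ⟨q, r, f w, ?_⟩
      simp)

/-- The functor `W ↦ Q ⊗ W` from modules over the reduction to `A`-modules. -/
def Ind : ModuleCat.{u} (Reduction k T) ⥤ ModuleCat.{u} A where
  obj W := ModuleCat.of _ (ind k T W)
  map f := ModuleCat.ofHom (indMap k T f.hom)
  map_id W := by
    ext : 1
    apply Submodule.linearMap_qext
    apply TensorProduct.AlgebraTensorModule.ext
    intro q w
    rfl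
  map_comp f g := by
    ext : 1
    apply Submodule.linearMap_qext
    apply TensorProduct.AlgebraTensorModule.ext
    intro q w
    rfl

/-! ### Categories of modules -/

/-- Finitely generated `A`-modules on which every element of `T` acts locally nilpotently. -/
def whittaker : ObjectProperty (ModuleCat.{u} A) := fun V =>
  Module.Finite A V ∧ ∀ t ∈ T, ∀ v : V, ∃ n : ℕ, 0 < n ∧ t ^ n • v = 0

/-- Finitely generated modules. -/
def finitelyGenerated (R : Type u) [Ring R] : ObjectProperty (ModuleCat.{u} R) := fun V =>
  Module.Finite R V

end Reduction

/-- The functors `F` and `G` restrict to mutually inverse equivalences between the full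
subcategories given by `P` and `P'`. -/
def RestrictToEquivalence {C D : Type*} [Category C] [Category D] (F : C ⥤ D) (G : D ⥤ C)
    (P : ObjectProperty C) (P' : ObjectProperty D) : Prop :=
  ∃ (hF : ∀ X, P X → P' (F.obj X)) (hG : ∀ Y, P' Y → P (G.obj Y))
    (e : P.FullSubcategory ≌ P'.FullSubcategory),
    e.functor = P'.lift (P.ι ⋙ F) (fun X => hF _ X.property) ∧
    e.inverse = P.lift (P'.ι ⋙ G) (fun Y => hG _ Y.property)

/-! ### Good gradings, good algebras and finite W-algebras -/

section Lie

variable {g : Type u} [LieRing g] [LieAlgebra ℂ g]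

/-- `Γ` is a `ℤ`-grading of the Lie algebra `g` that is good for `f`. -/
structure IsGoodGrading (Γ : ℤ → Submodule ℂ g) (f : g) : Prop where
  isInternal : DirectSum.IsInternal Γ
  lie_mem : ∀ i j, ∀ x ∈ Γ i, ∀ y ∈ Γ j, ⁅x, y⁆ ∈ Γ (i + j)
  mem : f ∈ Γ (-2)
  injective : ∀ j, 1 ≤ j → ∀ x ∈ Γ j, ⁅f, x⁆ = 0 → x = 0
  surjective : ∀ j, j ≤ 1 → ∀ y ∈ Γ (j - 2), ∃ x ∈ Γ j, ⁅f, x⁆ = y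

/-- `q` is the element of `g` that defines the grading: `Γ j` is the eigenspace of `ad q` for
the eigenvalue `j`. -/
def IsGradingElement (q : g) (Γ : ℤ → Submodule ℂ g) : Prop :=
  ∀ (j : ℤ) (x : g), x ∈ Γ j ↔ ⁅q, x⁆ = (j : ℂ) • x

/-- `m = l ⊕ ⨁_{i ≥ 2} Γ i` for a subspace `l` of `Γ 1` which is Lagrangian for the form
`χ([x, y])`, i.e. equal to its own orthogonal in `Γ 1`. -/
def IsGoodAlgebra (Γ : ℤ → Submodule ℂ g) (χ : Module.Dual ℂ g) (m : LieSubalgebra ℂ g) :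
    Prop :=
  ∃ l : Submodule ℂ g, (∀ x, x ∈ l ↔ x ∈ Γ 1 ∧ ∀ y ∈ l, χ ⁅x, y⁆ = 0) ∧
    m.toSubmodule = l ⊔ ⨆ (i : ℤ) (_ : 2 ≤ i), Γ i

/-- The elements `y - χ(y)` of `U(g)`, for `y ∈ m`. -/
def shift (χ : Module.Dual ℂ g) (m : LieSubalgebra ℂ g) :
    Set (UniversalEnvelopingAlgebra ℂ g) :=
  twisted (fun y : m => UniversalEnvelopingAlgebra.ι ℂ (y : g)) (fun y : m => χ (y : g))

/-- The finite W-algebra `(U(g) / Î)^{ad m}`, where `Î` is the left ideal generated by the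
`y - χ(y)`, `y ∈ m`. -/
abbrev FiniteW (χ : Module.Dual ℂ g) (m : LieSubalgebra ℂ g) : Type u :=
  Reduction ℂ (shift χ m)

/-- The elements `y - χ'(y) mod Î` of the finite W-algebra of `(χ, m)`, for `y ∈ m₀`. -/
def shift₀ (χ : Module.Dual ℂ g) (m : LieSubalgebra ℂ g) (χ' : Module.Dual ℂ g)
    (m₀ : LieSubalgebra ℂ g)
    (h : ∀ y ∈ m₀, UniversalEnvelopingAlgebra.ι ℂ y ∈ normalizer ℂ (shift χ m)) :
    Set (FiniteW χ m) :=
  twisted (fun y : m₀ => cls ℂ (shift χ m) (UniversalEnvelopingAlgebra.ι ℂ (y : g)) (h y y.2))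
    (fun y : m₀ => χ' (y : g))

/-- The category `W(g, f, m)` of finitely generated `U(g)`-modules on which the `y - χ(y)`,
`y ∈ m`, act locally nilpotently. -/
abbrev WhittakerModules (χ : Module.Dual ℂ g) (m : LieSubalgebra ℂ g) :
    ObjectProperty (ModuleCat.{u} (UniversalEnvelopingAlgebra ℂ g)) :=
  whittaker (shift χ m)

end Lie

/-! ### The second stage, with the reduction `U₀` of `A` identified with `R` -/

section SecondStage

variable {A R : Type u} [Ring A] [Algebra ℂ A] [Ring R] [Algebra ℂ R] (T : Set A)
  (Ψ : Reduction ℂ T ≃ₐ[ℂ] R)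

/-- `Whi`, seen as a functor to `R`-modules through `Ψ`. -/
def WhiVia : ModuleCat.{u} A ⥤ ModuleCat.{u} R :=
  Whi ℂ T ⋙ ModuleCat.restrictScalars (Ψ.symm : R →+* Reduction ℂ T)

/-- `Ind`, seen as a functor from `R`-modules through `Ψ`. -/
def IndVia : ModuleCat.{u} R ⥤ ModuleCat.{u} A :=
  ModuleCat.restrictScalars (Ψ : Reduction ℂ T →+* R) ⋙ Ind ℂ T

end SecondStage

end Stages

end

noncomputable section

namespace Stages

section LocallyNilpotent

variable {A : Type*} [Ring A]

/-- The vectors of `V` that are killed by a power of `t`. -/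
def nilVectors (t : A) (V : Type*) [AddCommGroup V] [Module A V] : AddSubgroup V where
  carrier := {v | ∃ n : ℕ, t ^ n • v = 0}
  zero_mem' := ⟨0, smul_zero _⟩
  add_mem' := by
    rintro v w ⟨n, hn⟩ ⟨m, hm⟩
    refine ⟨n + m, ?_⟩
    rw [smul_add, pow_add, mul_smul _ _ w, hm, smul_zero, add_zero, ← pow_add, add_comm, pow_add,
      mul_smul, hn, smul_zero]
  neg_mem' := by
    rintro v ⟨n, hn⟩
    exact ⟨n, by rw [smul_neg, hn, neg_zero]⟩

/-- Every element of `T` acts locally nilpotently on `V`. -/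
def LocNil (T : Set A) (V : Type*) [AddCommGroup V] [Module A V] : Prop :=
  ∀ t ∈ T, ∀ v : V, v ∈ nilVectors t V

variable {T : Set A} {V W : Type*} [AddCommGroup V] [Module A V] [AddCommGroup W] [Module A W]

theorem map_mem_nilVectors (f : V →ₗ[A] W) {t : A} {v : V} (hv : v ∈ nilVectors t V) :
    f v ∈ nilVectors t W := by
  obtain ⟨n, hn⟩ := hv
  exact ⟨n, by rw [← map_smul, hn, map_zero]⟩

theorem LocNil.of_injective (hW : LocNil T W) (f : V →ₗ[A] W) (hf : Function.Injective f) :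
    LocNil T V := by
  intro t ht v
  obtain ⟨n, hn⟩ := hW t ht (f v)
  exact ⟨n, hf (by rw [map_smul, hn, map_zero])⟩

theorem LocNil.of_surjective (hV : LocNil T V) (f : V →ₗ[A] W) (hf : Function.Surjective f) :
    LocNil T W := by
  intro t ht w
  obtain ⟨v, rfl⟩ := hf w
  exact map_mem_nilVectors f (hV t ht v)

theorem LocNil.finsupp (hV : LocNil T V) (I : Type*) : LocNil T (I →₀ V) := by
  intro t ht x
  induction x using Finsupp.induction_linear with
  | zero => exact zero_mem _
  | add x y hx hy => exact add_mem hx hy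
  | single i v => exact map_mem_nilVectors (Finsupp.lsingle i : V →ₗ[A] I →₀ V) (hV t ht v)

theorem LocNil.mono {T' : Set A} (hV : LocNil T V) (h : T' ⊆ T) : LocNil T' V :=
  fun t ht => hV t (h ht)

theorem mem_nilVectors_of_smul_mem {t : A} {v : V} (h : t • v ∈ nilVectors t V) :
    v ∈ nilVectors t V := by
  obtain ⟨n, hn⟩ := h
  exact ⟨n + 1, by rw [pow_succ, mul_smul, hn]⟩

theorem smul_smul_eq_add_lie_smul (a b : A) (v : V) : a • b • v = b • a • v + ⁅a, b⁆ • v := by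
  rw [Ring.lie_def, sub_smul, mul_smul, mul_smul, add_sub_cancel]

theorem smul_mem_nilVectors {t a : A} {m : ℕ} (ha : (fun b => ⁅t, b⁆)^[m] a = 0) {v : V}
    (hv : v ∈ nilVectors t V) : a • v ∈ nilVectors t V := by
  induction m generalizing a v with
  | zero =>
    rw [Function.iterate_zero, id] at ha
    rw [ha, zero_smul]
    exact zero_mem _
  | succ m ihm =>
    obtain ⟨n, hn⟩ := hv
    induction n generalizing v with
    | zero =>
      rw [pow_zero, one_smul] at hn
      rw [hn, smul_zero]
      exact zero_mem _
    | succ n ihn =>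
      rw [pow_succ, mul_smul] at hn
      apply mem_nilVectors_of_smul_mem
      rw [smul_smul_eq_add_lie_smul]
      exact add_mem (ihn hn) (ihm ha ⟨n + 1, by rw [pow_succ, mul_smul, hn]⟩)

end LocallyNilpotent

section Morita

variable {A : Type u} [Ring A] {k : Type*} [CommRing k] [Algebra k A] {T : Set A}

variable (k) in
theorem mk_mem_whi_iff {X : A} :
    (Submodule.Quotient.mk X : Q T) ∈ whi T (Q T) ↔ X ∈ normalizer k T := by
  refine forall₂_congr fun t ht => ?_
  rw [← Submodule.Quotient.mk_smul, Submodule.Quotient.mk_eq_zero, smul_eq_mul, Ring.lie_def]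
  exact (Submodule.sub_mem_iff_left _
    ((Ideal.span T).mul_mem_left X (Ideal.subset_span ht))).symm

theorem one_mem_whi : (Submodule.Quotient.mk 1 : Q T) ∈ whi T (Q T) :=
  (mk_mem_whi_iff ℤ).2 (one_mem _)

theorem cls_surjective (r : Reduction k T) : ∃ X hX, cls k T X hX = r := by
  obtain ⟨X, rfl⟩ := Ideal.Quotient.mk_surjective r
  exact ⟨X.1, X.2, rfl⟩

theorem cls_eq_zero_iff {X : A} {hX : X ∈ normalizer k T} :
    cls k T X hX = 0 ↔ X ∈ Ideal.span T :=
  Ideal.Quotient.eq_zero_iff_mem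

/-- The class of `1` in `Q = A / A T`, as a vector killed by a subset `T'` of `T`. -/
def oneVec {T' : Set A} (h : T' ⊆ T) : whi T' (Q T) :=
  ⟨Submodule.Quotient.mk 1, fun t ht => one_mem_whi t (h ht)⟩

theorem cls_smul_oneVec {T' : Set A} (h : T' ⊆ T) {X : A} (hX : X ∈ normalizer k T') :
    ((cls k T' X hX • oneVec h : whi T' (Q T)) : Q T) = Submodule.Quotient.mk X :=
  congrArg Submodule.Quotient.mk (mul_one X)

theorem eq_zero_of_smul_oneVec_eq_zero {r : Reduction k T}
    (h : r • oneVec (subset_refl T) = 0) : r = 0 := by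
  obtain ⟨X, hX, rfl⟩ := cls_surjective r
  rw [cls_eq_zero_iff, ← Submodule.Quotient.mk_eq_zero, ← cls_smul_oneVec subset_rfl hX, h]
  rfl

/-- The homomorphism `Q → V`, `a mod A T ↦ a v`, for a vector `v` killed by `T`. -/
def whiHom {V : Type*} [AddCommGroup V] [Module A V] (v : whi T V) : Q T →ₗ[A] V :=
  Submodule.liftQ _ (LinearMap.toSpanSingleton A V (v : V))
    fun _ ha => smul_eq_zero_of_mem_span ha v

theorem whiHom_mk {V : Type*} [AddCommGroup V] [Module A V] (v : whi T V) (a : A) :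
    whiHom v (Submodule.Quotient.mk a) = a • (v : V) :=
  rfl

variable {W : Type*} [AddCommGroup W] [Module (Reduction k T) W]

/-- The homomorphism `Q ⊗ W → V`, `a ⊗ w ↦ a h(w)`. -/
def indLift {V : Type*} [AddCommGroup V] [Module A V]
    (h : W →ₗ[Reduction k T] whi T V) : ind k T W →ₗ[A] V :=
  Submodule.liftQ _
    (TensorProduct.AlgebraTensorModule.lift
      { toFun := fun q =>
          AddMonoidHom.toIntLinearMap
            { toFun := fun w => whiHom (h w) q
              map_zero' := by
                obtain ⟨a, rfl⟩ := Submodule.Quotient.mk_surjective _ q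
                rw [whiHom_mk, map_zero]
                exact smul_zero a
              map_add' := fun w w' => by
                obtain ⟨a, rfl⟩ := Submodule.Quotient.mk_surjective _ q
                rw [whiHom_mk, map_add]
                exact smul_add a _ _ }
        map_add' := fun q q' => by ext w; exact map_add (whiHom (h w)) q q'
        map_smul' := fun a q => by ext w; exact map_smul (whiHom (h w)) a q })
    (by
      rw [indRel, Submodule.span_le]
      rintro _ ⟨q, r, w, rfl⟩
      obtain ⟨a, rfl⟩ := Submodule.Quotient.mk_surjective _ q
      obtain ⟨X, hX, rfl⟩ := cls_surjective r
      refine LinearMap.mem_ker.2 ?_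
      rw [map_sub, sub_eq_zero]
      change (a * X) • (h w : V) = a • (h (cls k T X hX • w) : V)
      rw [map_smul, cls_smul_coe, mul_smul])

variable (k T W) in
/-- The unit `W → Whi(Q ⊗ W)`, `w ↦ 1 ⊗ w`. -/
def indUnit : W →ₗ[Reduction k T] whi T (ind k T W) where
  toFun w := ⟨Submodule.Quotient.mk ((Submodule.Quotient.mk 1 : Q T) ⊗ₜ[ℤ] w), fun t ht => by
    rw [← Submodule.Quotient.mk_smul, TensorProduct.smul_tmul', one_mem_whi t ht,
      TensorProduct.zero_tmul]
    rfl⟩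
  map_add' w w' := Subtype.ext
    (congrArg Submodule.Quotient.mk (TensorProduct.tmul_add (Submodule.Quotient.mk 1 : Q T) w w'))
  map_smul' r w := by
    obtain ⟨X, hX, rfl⟩ := cls_surjective r
    have h : (Submodule.Quotient.mk ((Submodule.Quotient.mk (1 * X) : Q T) ⊗ₜ[ℤ] w) :
        ind k T W) = Submodule.Quotient.mk ((Submodule.Quotient.mk 1 : Q T) ⊗ₜ[ℤ]
          (cls k T X hX • w)) :=
      (Submodule.Quotient.eq _).2 (Submodule.subset_span
        ⟨Submodule.Quotient.mk 1, cls k T X hX, w, rfl⟩)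
    refine Subtype.ext (h.symm.trans ?_)
    change _ = X • (Submodule.Quotient.mk ((Submodule.Quotient.mk 1 : Q T) ⊗ₜ[ℤ] w) : ind k T W)
    rw [← Submodule.Quotient.mk_smul, TensorProduct.smul_tmul', ← Submodule.Quotient.mk_smul,
      smul_eq_mul, mul_one, one_mul]

theorem smul_indUnit (a : A) (w : W) : a • (indUnit k T W w : ind k T W) =
    Submodule.Quotient.mk ((Submodule.Quotient.mk a : Q T) ⊗ₜ[ℤ] w) := by
  change a • (Submodule.Quotient.mk ((Submodule.Quotient.mk 1 : Q T) ⊗ₜ[ℤ] w) : ind k T W) = _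
  rw [← Submodule.Quotient.mk_smul, TensorProduct.smul_tmul', ← Submodule.Quotient.mk_smul,
      smul_eq_mul, mul_one]

theorem indLift_indUnit {V : Type*} [AddCommGroup V] [Module A V]
    (h : W →ₗ[Reduction k T] whi T V) (w : W) :
    indLift h (indUnit k T W w : ind k T W) = (h w : V) :=
  one_smul A _

@[elab_as_elim]
theorem ind_induction {p : ind k T W → Prop} (zero : p 0)
    (smul : ∀ (a : A) (w : W), p (a • (indUnit k T W w : ind k T W)))
    (add : ∀ x y, p x → p y → p (x + y)) (x : ind k T W) : p x := by
  obtain ⟨z, rfl⟩ := Submodule.Quotient.mk_surjective _ x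
  induction z using TensorProduct.induction_on with
  | zero => exact zero
  | tmul q w =>
    obtain ⟨a, rfl⟩ := Submodule.Quotient.mk_surjective _ q
    rw [← smul_indUnit]
    exact smul a w
  | add x y hx hy => exact add _ _ hx hy

theorem ind_hom_ext {V : Type*} [AddCommGroup V] [Module A V] {f g : ind k T W →ₗ[A] V}
    (h : ∀ w, f (indUnit k T W w : ind k T W) = g (indUnit k T W w : ind k T W)) : f = g := by
  refine LinearMap.ext fun x => ?_
  induction x using ind_induction with
  | zero => simp
  | smul a w => rw [map_smul, map_smul, h]
  | add x y hx hy => rw [map_add, map_add, hx, hy]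

variable (k T W) in
theorem ind_locNil (hQ : LocNil T (Q T)) : LocNil T (ind k T W) := by
  intro t ht x
  induction x using ind_induction with
  | zero => exact zero_mem _
  | smul a w =>
    exact map_mem_nilVectors (whiHom (indUnit k T W w)) (hQ t ht (Submodule.Quotient.mk a))
  | add x y hx hy => exact add_mem hx hy

variable (k T W) in
theorem span_indUnit : Submodule.span A
    (Set.range fun w => (indUnit k T W w : ind k T W)) = ⊤ := by
  rw [eq_top_iff]
  rintro x -
  induction x using ind_induction with
  | zero => exact zero_mem _
  | smul a w => exact Submodule.smul_mem _ _ (Submodule.subset_span ⟨w, rfl⟩)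
  | add x y hx hy => exact add_mem hx hy

variable (k T W) in
theorem ind_finite [Module.Finite (Reduction k T) W] : Module.Finite A (ind k T W) := by
  obtain ⟨s, hs⟩ := ‹Module.Finite (Reduction k T) W›.fg_top
  refine ⟨Submodule.fg_def.2
    ⟨(fun w => (indUnit k T W w : ind k T W)) '' s, s.finite_toSet.image _, ?_⟩⟩
  rw [← span_indUnit k T W]
  refine le_antisymm (Submodule.span_mono (Set.image_subset_range _ _)) (Submodule.span_le.2 ?_)
  rintro _ ⟨w, rfl⟩
  rw [SetLike.mem_coe]
  beta_reduce
  have hw : w ∈ Submodule.span (Reduction k T) (s : Set W) := hs ▸ Submodule.mem_top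
  induction hw using Submodule.span_induction with
  | mem w hw => exact Submodule.subset_span ⟨w, hw, rfl⟩
  | zero => rw [map_zero]; exact zero_mem _
  | add x y _ _ hx hy => rw [map_add]; exact add_mem hx hy
  | smul r x _ hx =>
    obtain ⟨X, hX, rfl⟩ := cls_surjective r
    rw [map_smul, cls_smul_coe]
    exact Submodule.smul_mem _ _ hx

variable (k T) in
/-- The embedding of the free module on `I` into `Whi(Q^(I))`. -/
def finsuppToWhi (I : Type*) : (I →₀ Reduction k T) →ₗ[Reduction k T] whi T (I →₀ Q T) :=
  Finsupp.linearCombination _ fun i => whiMap k T (Finsupp.lsingle i) (oneVec subset_rfl)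

variable (k T) in
theorem finsuppToWhi_injective (I : Type*) : Function.Injective (finsuppToWhi k T I) := by
  rw [injective_iff_map_eq_zero]
  intro f hf
  ext i
  have hcoord : whiMap k T (Finsupp.lapply i) ∘ₗ finsuppToWhi k T I =
      LinearMap.toSpanSingleton _ _ (oneVec subset_rfl) ∘ₗ Finsupp.lapply i := by
    ext i'
    by_cases h : i' = i
    · subst h
      simp [finsuppToWhi, whiMap]
    · simp [finsuppToWhi, whiMap, h]
  apply eq_zero_of_smul_oneVec_eq_zero
  have h := LinearMap.congr_fun hcoord f
  rw [LinearMap.comp_apply, hf, map_zero] at h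
  exact h.symm

/-- `Q` is a projective generator of the category of the modules on which `T` acts locally
nilpotently. Since `Hom(Q, V) = Whi(V)`, this means that `Q` lies in this category, that `Whi` maps
the quotients `V → V ⧸ K` in it to surjective homomorphisms, and that `Whi(V) = 0` only for
`V = 0`. -/
structure IsProjectiveGenerator (T : Set A) : Prop where
  locNil : LocNil T (Q T)
  exists_sub_mem : ∀ (V : Type u) [AddCommGroup V] [Module A V], LocNil T V →
    ∀ (K : Submodule A V) (v : V), (∀ t ∈ T, t • v ∈ K) → ∃ w ∈ K, v - w ∈ whi T V
  eq_zero : ∀ (V : Type u) [AddCommGroup V] [Module A V], LocNil T V →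
    (∀ v ∈ whi T V, v = 0) → ∀ v : V, v = 0

namespace IsProjectiveGenerator

variable {V : Type u} [AddCommGroup V] [Module A V]

theorem mem_of_coe_mem_span (hT : IsProjectiveGenerator T) (N : Submodule (Reduction k T) (whi T V))
    (v : whi T V) (hv : (v : V) ∈ Submodule.span A ((↑) '' (N : Set (whi T V)) : Set V)) :
    v ∈ N := by
  let π : (N →₀ Q T) →ₗ[A] V := Finsupp.lsum ℕ fun n => whiHom n.1
  have hπ (n : N) (q : Q T) : π (Finsupp.single n q) = whiHom n.1 q := by
    simp [π]
  have hle : Submodule.span A ((↑) '' (N : Set (whi T V)) : Set V) ≤ LinearMap.range π := by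
    rw [Submodule.span_le]
    rintro _ ⟨n, hn, rfl⟩
    exact ⟨Finsupp.single ⟨n, hn⟩ (Submodule.Quotient.mk 1), by
      rw [hπ, whiHom_mk, one_smul]⟩
  obtain ⟨x, hx⟩ := hle hv
  obtain ⟨w, hw, hxw⟩ := hT.exists_sub_mem (N →₀ Q T) (hT.locNil.finsupp N) (LinearMap.ker π) x
    fun t ht => by rw [LinearMap.mem_ker, map_smul, hx, v.2 t ht]
  have hy : π (x - w) = v := by rw [map_sub, hx, LinearMap.mem_ker.1 hw, sub_zero]
  have hmem : π (x - w) ∈ N.toAddSubgroup.map (whi T V).subtype := by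
    have : π (x - w) = (x - w).sum fun n q => whiHom n.1 q := rfl
    rw [this]
    refine sum_mem fun n _ => ?_
    obtain ⟨X, hX⟩ := Submodule.Quotient.mk_surjective _ ((x - w) n)
    have hXn : X ∈ normalizer k T := by
      rw [← mk_mem_whi_iff k, hX]
      exact fun t ht => by rw [← Finsupp.smul_apply, hxw t ht]; rfl
    exact ⟨cls k T X hXn • n.1, N.smul_mem _ n.2, by rw [← hX]; rfl⟩
  rw [hy] at hmem
  obtain ⟨n, hn, hnv⟩ := hmem
  rwa [← Subtype.ext hnv]

variable {W : Type u} [AddCommGroup W] [Module (Reduction k T) W]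

theorem indUnit_surjective (hT : IsProjectiveGenerator T) :
    Function.Surjective (indUnit k T W) := by
  intro v
  refine hT.mem_of_coe_mem_span (LinearMap.range (indUnit k T W)) v ?_
  have h := span_indUnit k T W
  rw [Set.range_comp' (fun v : whi T (ind k T W) => (v : ind k T W)),
    ← LinearMap.coe_range] at h
  rw [h]
  exact Submodule.mem_top

variable (W) in
theorem exists_injective_whi (hT : IsProjectiveGenerator T) :
    ∃ (V : ModuleCat.{u} A) (h : W →ₗ[Reduction k T] whi T V), Function.Injective h := by
  let c : (W →₀ Reduction k T) →ₗ[Reduction k T] W := Finsupp.linearCombination _ id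
  have hc : Function.Surjective c := Finsupp.linearCombination_id_surjective _ _
  let j := finsuppToWhi k T W
  let N : Submodule (Reduction k T) (whi T (W →₀ Q T)) := (LinearMap.ker c).map j
  let M : Submodule A (W →₀ Q T) :=
    Submodule.span A ((↑) '' (N : Set (whi T (W →₀ Q T))) : Set (W →₀ Q T))
  let p := whiMap k T M.mkQ ∘ₗ j
  have hp (f : W →₀ Reduction k T) : f ∈ LinearMap.ker p ↔ (j f : W →₀ Q T) ∈ M :=
    Subtype.ext_iff.trans (Submodule.Quotient.mk_eq_zero M)
  have hker : LinearMap.ker p = LinearMap.ker c := by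
    ext f
    rw [hp]
    refine ⟨fun hf => ?_, fun hf => Submodule.subset_span ⟨j f, ⟨f, hf, rfl⟩, rfl⟩⟩
    obtain ⟨f', hf', h⟩ := hT.mem_of_coe_mem_span N _ hf
    rwa [← finsuppToWhi_injective k T W h]
  have hlift : Function.Injective ((LinearMap.ker c).liftQ p hker.ge) :=
    LinearMap.ker_eq_bot.1 (Submodule.ker_liftQ_eq_bot _ _ _ hker.le)
  exact ⟨ModuleCat.of A ((W →₀ Q T) ⧸ M),
    (LinearMap.ker c).liftQ p hker.ge ∘ₗ (c.quotKerEquivOfSurjective hc).symm.toLinearMap,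
    hlift.comp (LinearEquiv.injective _)⟩

theorem indUnit_injective (hT : IsProjectiveGenerator T) :
    Function.Injective (indUnit k T W) := by
  obtain ⟨V, h, hh⟩ := hT.exists_injective_whi (k := k) W
  intro w w' hw
  apply hh
  apply Subtype.ext
  rw [← indLift_indUnit h w, hw, indLift_indUnit]

theorem indUnit_bijective (hT : IsProjectiveGenerator T) :
    Function.Bijective (indUnit k T W) :=
  ⟨hT.indUnit_injective, hT.indUnit_surjective⟩

theorem span_whi_eq_top (hT : IsProjectiveGenerator T) (hV : LocNil T V) :
    Submodule.span A (whi T V : Set V) = ⊤ := by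
  set M := Submodule.span A (whi T V : Set V)
  rw [eq_top_iff]
  rintro v -
  rw [← Submodule.Quotient.mk_eq_zero]
  refine hT.eq_zero (V ⧸ M) (hV.of_surjective M.mkQ M.mkQ_surjective) ?_ _
  intro x hx
  obtain ⟨x, rfl⟩ := Submodule.Quotient.mk_surjective _ x
  obtain ⟨w, hw, hxw⟩ := hT.exists_sub_mem V hV M x fun t ht =>
    (Submodule.Quotient.mk_eq_zero M).1 (hx t ht)
  rw [Submodule.Quotient.mk_eq_zero]
  simpa using add_mem (Submodule.subset_span hxw : x - w ∈ M) hw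

theorem indLift_surjective (hT : IsProjectiveGenerator T) (hV : LocNil T V)
    {h : W →ₗ[Reduction k T] whi T V} (hh : Function.Surjective h) :
    Function.Surjective (indLift h) := by
  rw [← LinearMap.range_eq_top, eq_top_iff, ← hT.span_whi_eq_top hV, Submodule.span_le]
  intro v hv
  obtain ⟨w, hw⟩ := hh ⟨v, hv⟩
  exact ⟨_, (indLift_indUnit h w).trans (congrArg Subtype.val hw)⟩

theorem indLift_injective (hT : IsProjectiveGenerator T)
    {h : W →ₗ[Reduction k T] whi T V} (hh : Function.Injective h) :
    Function.Injective (indLift h) := by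
  rw [injective_iff_map_eq_zero]
  intro x hx
  have := hT.eq_zero (LinearMap.ker (indLift h))
    ((ind_locNil k T W hT.locNil).of_injective _ (Submodule.subtype_injective _))
    (fun u hu => by
      obtain ⟨w, hw⟩ := hT.indUnit_surjective (k := k) (W := W)
        ⟨u.1, fun t ht => congrArg Subtype.val (hu t ht)⟩
      have h₀ : (h w : V) = 0 := by
        rw [← LinearMap.mem_ker.1 u.2, ← congrArg Subtype.val hw]
        exact (indLift_indUnit h w).symm
      have h₁ : w = 0 := (injective_iff_map_eq_zero h).1 hh w (Subtype.ext h₀)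
      rw [h₁, map_zero] at hw
      exact Subtype.ext (congrArg Subtype.val hw).symm) ⟨x, hx⟩
  exact congrArg Subtype.val this

theorem indLift_bijective (hT : IsProjectiveGenerator T) (hV : LocNil T V)
    {h : W →ₗ[Reduction k T] whi T V} (hh : Function.Bijective h) :
    Function.Bijective (indLift h) :=
  ⟨hT.indLift_injective hh.1, hT.indLift_surjective hV hh.2⟩

variable (k) in
theorem whi_finite (hT : IsProjectiveGenerator T) (hV : LocNil T V) [hf : Module.Finite A V] :
    Module.Finite (Reduction k T) (whi T V) := by
  have h := hf.fg_top
  rw [← hT.span_whi_eq_top hV, Submodule.fg_span_iff_fg_span_finset_subset] at h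
  obtain ⟨s, hs, hspan⟩ := h
  rw [hT.span_whi_eq_top hV] at hspan
  refine ⟨Submodule.fg_def.2 ⟨Subtype.val ⁻¹' s,
    s.finite_toSet.preimage Subtype.val_injective.injOn, ?_⟩⟩
  rw [eq_top_iff]
  rintro v -
  refine hT.mem_of_coe_mem_span _ v ?_
  set N := Submodule.span (Reduction k T) (Subtype.val ⁻¹' (s : Set V) : Set (whi T V)) with hN
  have hle : Submodule.span A (s : Set V) ≤
      Submodule.span A ((↑) '' (N : Set (whi T V)) : Set V) := by
    refine Submodule.span_mono fun x hx => ⟨⟨x, hs hx⟩, ?_, rfl⟩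
    rw [hN]
    exact Submodule.subset_span hx
  rw [← hspan] at hle
  exact hle Submodule.mem_top

end IsProjectiveGenerator

end Morita

section Equivalences

theorem RestrictToEquivalence.of_natTrans {C D : Type*} [Category C] [Category D] {F : C ⥤ D}
    {G : D ⥤ C} {P : ObjectProperty C} {P' : ObjectProperty D}
    (hF : ∀ X, P X → P' (F.obj X)) (hG : ∀ Y, P' Y → P (G.obj Y))
    (η : 𝟭 D ⟶ G ⋙ F) (ε : F ⋙ G ⟶ 𝟭 C)
    (hη : ∀ Y, P' Y → IsIso (η.app Y)) (hε : ∀ X, P X → IsIso (ε.app X)) :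
    RestrictToEquivalence F G P P' := by
  let F' := P'.lift (P.ι ⋙ F) fun X => hF _ X.property
  let G' := P.lift (P'.ι ⋙ G) fun Y => hG _ Y.property
  let counitIso : F' ⋙ G' ≅ 𝟭 _ := NatIso.ofComponents
    (fun X => haveI := hε X.obj X.property; P.isoMk (asIso (ε.app X.obj)))
    fun f => P.hom_ext (ε.naturality f.hom)
  let unitIso : 𝟭 _ ≅ G' ⋙ F' := NatIso.ofComponents
    (fun Y => haveI := hη Y.obj Y.property; P'.isoMk (asIso (η.app Y.obj)))
    fun f => P'.hom_ext (η.naturality f.hom)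
  exact ⟨hF, hG, CategoryTheory.Equivalence.mk F' G' counitIso.symm unitIso.symm, rfl, rfl⟩

theorem RestrictToEquivalence.of_natTrans_comp {C D E : Type*} [Category C] [Category D]
    [Category E] {F : C ⥤ D} {G : D ⥤ C} {S : D ⥤ E} {S' : E ⥤ D} {P : ObjectProperty C}
    {P' : ObjectProperty E} (hF : ∀ X, P X → P' (S.obj (F.obj X)))
    (hG : ∀ Y, P' Y → P (G.obj (S'.obj Y))) (e : S' ⋙ S ≅ 𝟭 E) (e' : S ⋙ S' ≅ 𝟭 D)
    (η : 𝟭 D ⟶ G ⋙ F) (ε : F ⋙ G ⟶ 𝟭 C)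
    (hη : ∀ Y, P' Y → IsIso (η.app (S'.obj Y))) (hε : ∀ X, P X → IsIso (ε.app X)) :
    RestrictToEquivalence (F ⋙ S) (S' ⋙ G) P P' := by
  refine of_natTrans hF hG (e.inv ≫ S'.whiskerLeft (Functor.whiskerRight η S))
    (F.whiskerLeft (Functor.whiskerRight e'.hom G) ≫ ε) (fun Y hY => ?_) fun X hX => ?_
  · have := hη Y hY
    exact inferInstanceAs (IsIso (e.inv.app Y ≫ S.map (η.app (S'.obj Y))))
  · have := hε X hX
    exact inferInstanceAs (IsIso (G.map (e'.hom.app (F.obj X)) ≫ ε.app X))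

theorem isIso_of_bijective {R : Type*} [Ring R] {M N : ModuleCat R} (f : M ⟶ N)
    (hf : Function.Bijective f.hom) : IsIso f :=
  (LinearEquiv.ofBijective f.hom hf).toModuleIso.isIso_hom

theorem finite_restrictScalars {R S : Type u} [Ring R] [Ring S] (e : R ≃+* S) (M : ModuleCat.{u} S)
    [Module.Finite S M] :
    Module.Finite R ((ModuleCat.restrictScalars (e : R →+* S)).obj M) := by
  refine Module.Finite.of_surjective (R := S) (M := M) (σ := (e.symm : S →+* R))
    { toFun := fun m => m
      map_add' := fun _ _ => rfl
      map_smul' := fun s m => ?_ } Function.surjective_id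
  refine Eq.trans ?_ (ModuleCat.restrictScalars.smul_def (e : R →+* S) (e.symm s) m).symm
  exact congrArg (fun x : S => x • m) (e.apply_symm_apply s).symm

/-- Restriction of scalars along `f` and then along a section `g` of `f` is the identity. -/
def restrictScalarsCompIso {R S : Type u} [Ring R] [Ring S] (f : R →+* S) (g : S →+* R)
    (h : f.comp g = RingHom.id S) :
    ModuleCat.restrictScalars.{u} f ⋙ ModuleCat.restrictScalars g ≅ 𝟭 _ :=
  (ModuleCat.restrictScalarsComp' g f _ h.symm).symm ≪≫ ModuleCat.restrictScalarsId' _ rfl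

/-- The identification of the targets of two surjective homomorphisms with the same kernel. -/
def algEquivOfKerEq {k S R R' : Type*} [CommRing k] [Ring S] [Ring R] [Ring R'] [Algebra k S]
    [Algebra k R] [Algebra k R'] {f : S →ₐ[k] R} {f' : S →ₐ[k] R'}
    (hf : Function.Surjective f) (hf' : Function.Surjective f')
    (h : RingHom.ker f = RingHom.ker f') : R ≃ₐ[k] R' :=
  (Ideal.quotientKerAlgEquivOfSurjective hf).symm.trans
    ((Ideal.quotientEquivAlgOfEq k h).trans (Ideal.quotientKerAlgEquivOfSurjective hf'))

theorem algEquivOfKerEq_apply {k S R R' : Type*} [CommRing k] [Ring S] [Ring R] [Ring R']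
    [Algebra k S] [Algebra k R] [Algebra k R'] {f : S →ₐ[k] R} {f' : S →ₐ[k] R'}
    (hf : Function.Surjective f) (hf' : Function.Surjective f')
    (h : RingHom.ker f = RingHom.ker f') (s : S) : algEquivOfKerEq hf hf' h (f s) = f' s := by
  simp [algEquivOfKerEq]

end Equivalences

section Functors

variable {A : Type u} [Ring A]

theorem whittaker_iff {T : Set A} {V : ModuleCat.{u} A} :
    whittaker T V ↔ Module.Finite A V ∧ LocNil T V := by
  refine and_congr Iff.rfl (forall₃_congr fun t _ v => ⟨fun ⟨n, _, hn⟩ => ⟨n, hn⟩, ?_⟩)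
  rintro ⟨n, hn⟩
  exact ⟨n + 1, n.succ_pos, by rw [pow_succ', mul_smul, hn, smul_zero]⟩

variable (k : Type*) [CommRing k] [Algebra k A] (T : Set A)

/-- The unit of the adjunction `Ind ⊣ Whi`. -/
def whiIndUnit : 𝟭 (ModuleCat.{u} (Reduction k T)) ⟶ Ind k T ⋙ Whi k T where
  app W := ModuleCat.ofHom (indUnit k T W)

/-- The counit of the adjunction `Ind ⊣ Whi`. -/
def whiIndCounit : Whi k T ⋙ Ind k T ⟶ 𝟭 (ModuleCat.{u} A) where
  app V := ModuleCat.ofHom (indLift (W := whi T V) LinearMap.id)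
  naturality V W f := by
    refine ModuleCat.hom_ext (ind_hom_ext fun v => ?_)
    exact (one_smul A _).trans (congrArg f.hom (one_smul A _)).symm

variable {k T}

theorem IsProjectiveGenerator.isIso_unit (hT : IsProjectiveGenerator T)
    (W : ModuleCat.{u} (Reduction k T)) : IsIso ((whiIndUnit k T).app W) :=
  isIso_of_bijective _ hT.indUnit_bijective

theorem IsProjectiveGenerator.isIso_counit (hT : IsProjectiveGenerator T)
    {V : ModuleCat.{u} A} (hV : LocNil T V) : IsIso ((whiIndCounit k T).app V) :=
  isIso_of_bijective _ (hT.indLift_bijective hV Function.bijective_id)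

theorem IsProjectiveGenerator.restrictToEquivalence_via {R : Type u} [Ring R] [Algebra ℂ A]
    [Algebra ℂ R] (hT : IsProjectiveGenerator T) (Ψ : Reduction ℂ T ≃ₐ[ℂ] R) :
    RestrictToEquivalence (WhiVia T Ψ) (IndVia T Ψ) (whittaker T) (finitelyGenerated R) := by
  refine RestrictToEquivalence.of_natTrans_comp (fun V hV => ?_) (fun W hW => ?_)
    (restrictScalarsCompIso _ _ (RingHom.ext Ψ.apply_symm_apply))
    (restrictScalarsCompIso _ _ (RingHom.ext Ψ.symm_apply_apply))
    (whiIndUnit ℂ T) (whiIndCounit ℂ T) (fun _ _ => hT.isIso_unit _)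
    fun V hV => hT.isIso_counit (whittaker_iff.1 hV).2
  · rw [whittaker_iff] at hV
    have := hV.1
    have : Module.Finite (Reduction ℂ T) ((Whi ℂ T).obj V) := hT.whi_finite ℂ hV.2
    exact finite_restrictScalars Ψ.symm.toRingEquiv ((Whi ℂ T).obj V)
  · have : Module.Finite R W := hW
    have : Module.Finite (Reduction ℂ T)
        ((ModuleCat.restrictScalars (Ψ : Reduction ℂ T →+* R)).obj W) :=
      finite_restrictScalars Ψ.toRingEquiv W
    exact whittaker_iff.2 ⟨ind_finite ℂ T _, ind_locNil ℂ T _ hT.locNil⟩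

end Functors

section TwoStages

variable {A : Type u} [Ring A] {k : Type*} [CommRing k] [Algebra k A]

theorem cls_eq_cls_iff {T : Set A} {X X' : A} {hX : X ∈ normalizer k T}
    {hX' : X' ∈ normalizer k T} :
    cls k T X hX = cls k T X' hX' ↔ X - X' ∈ Ideal.span T :=
  Ideal.Quotient.mk_eq_mk_iff_sub_mem _ _

theorem cls_pow_smul_coe {T : Set A} {V : Type*} [AddCommGroup V] [Module A V] {X : A}
    (hX : X ∈ normalizer k T) (n : ℕ) (v : whi T V) :
    ((cls k T X hX ^ n • v : whi T V) : V) = X ^ n • (v : V) := by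
  induction n with
  | zero => rw [pow_zero, pow_zero, one_smul, one_smul]
  | succ n ih => rw [pow_succ', pow_succ', mul_smul, mul_smul, cls_smul_coe, ih]

variable (k) in
/-- The homomorphism `X ↦ X mod A T` of algebras. -/
def clsHom (T : Set A) : normalizer k T →ₐ[k] Reduction k T :=
  Ideal.Quotient.mkₐ k (redIdeal k T)

theorem clsHom_eq_zero_iff {T : Set A} {X : normalizer k T} :
    clsHom k T X = 0 ↔ (X : A) ∈ Ideal.span T :=
  Ideal.Quotient.eq_zero_iff_mem

variable (k) in
/-- The data of a reduction of `A` by `T₂` in two stages: first by a subset `T₁` of `T₂` which is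
normalized by `T₂`, then by the set `T₀` of the classes of `T₂` in the reduction by `T₁`. Both
`A / A T₁` and `A / A T₂` are projective generators, and the vectors on which an element of `T₂`
acts nilpotently form a submodule in every `A`-module. -/
structure IsTwoStage (T₁ T₂ : Set A) (T₀ : Set (Reduction k T₁)) : Prop where
  gen₁ : IsProjectiveGenerator T₁
  gen₂ : IsProjectiveGenerator T₂
  smul_mem_nilVectors : ∀ (V : Type u) [AddCommGroup V] [Module A V], ∀ t ∈ T₂,
    ∀ v ∈ nilVectors t V, ∀ a : A, a • v ∈ nilVectors t V
  subset : T₁ ⊆ T₂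
  mem_normalizer : ∀ t ∈ T₂, t ∈ normalizer k T₁
  mem_iff : ∀ x, x ∈ T₀ ↔ ∃ (t : A) (ht : t ∈ T₂), x = cls k T₁ t (mem_normalizer t ht)

namespace IsTwoStage

variable {T₁ T₂ : Set A} {T₀ : Set (Reduction k T₁)}

theorem cls_mem (h : IsTwoStage k T₁ T₂ T₀) {t : A} (ht : t ∈ T₂) :
    cls k T₁ t (h.mem_normalizer t ht) ∈ T₀ :=
  (h.mem_iff _).2 ⟨t, ht, rfl⟩

theorem whi_le (h : IsTwoStage k T₁ T₂ T₀) {V : Type*} [AddCommGroup V] [Module A V] :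
    whi T₂ V ≤ whi T₁ V :=
  fun _ hv t ht => hv t (h.subset ht)

theorem coe_mem_whi_iff (h : IsTwoStage k T₁ T₂ T₀) {V : Type*} [AddCommGroup V] [Module A V]
    {v : whi T₁ V} : (v : V) ∈ whi T₂ V ↔ v ∈ whi T₀ (whi T₁ V) := by
  refine ⟨fun hv x hx => ?_, fun hv t ht => congrArg Subtype.val (hv _ (h.cls_mem ht))⟩
  obtain ⟨t, ht, rfl⟩ := (h.mem_iff x).1 hx
  exact Subtype.ext (hv t ht)

theorem oneVec_mem (h : IsTwoStage k T₁ T₂ T₀) : oneVec h.subset ∈ whi T₀ (whi T₁ (Q T₂)) :=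
  h.coe_mem_whi_iff.1 one_mem_whi

theorem cls_mem_span_iff (h : IsTwoStage k T₁ T₂ T₀) {X : A} (hX : X ∈ normalizer k T₁) :
    cls k T₁ X hX ∈ Ideal.span T₀ ↔ X ∈ Ideal.span T₂ := by
  constructor
  · intro hmem
    have := smul_eq_zero_of_mem_span hmem ⟨_, h.oneVec_mem⟩
    rw [← Submodule.Quotient.mk_eq_zero, ← cls_smul_oneVec h.subset hX, this]
    rfl
  · intro hmem
    let o : whi T₁ (Q T₁) := oneVec subset_rfl
    let N : Submodule (Reduction k T₁) (whi T₁ (Q T₁)) :=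
      Submodule.map (LinearMap.toSpanSingleton (Reduction k T₁) _ o) (Ideal.span T₀)
    have hle : Ideal.span T₂ ≤ Submodule.comap (Submodule.mkQ (Ideal.span T₁))
        (Submodule.span A ((↑) '' (N : Set (whi T₁ (Q T₁))) : Set (Q T₁))) :=
      Submodule.span_le.2 fun t ht => Submodule.subset_span
        ⟨_, ⟨_, Ideal.subset_span (h.cls_mem ht), rfl⟩, cls_smul_oneVec subset_rfl _⟩
    obtain ⟨r, hr, hrX⟩ := h.gen₁.mem_of_coe_mem_span N (cls k T₁ X hX • o) (by
      rw [cls_smul_oneVec]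
      exact hle hmem)
    have hrX' : (r - cls k T₁ X hX) • o = 0 := by
      rw [sub_smul, sub_eq_zero]
      exact hrX
    rwa [← sub_eq_zero.1 (eq_zero_of_smul_oneVec_eq_zero hrX')]

theorem exists_mk_eq (h : IsTwoStage k T₁ T₂ T₀) {q : Q T₂} (hq : q ∈ whi T₁ (Q T₂)) :
    ∃ X ∈ normalizer k T₁, Submodule.Quotient.mk X = q := by
  have hspan : q ∈ Submodule.span A ((↑) '' ((Submodule.span (Reduction k T₁)
      {oneVec h.subset} : Submodule _ _) : Set (whi T₁ (Q T₂))) : Set (Q T₂)) := by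
    obtain ⟨a, rfl⟩ := Submodule.Quotient.mk_surjective _ q
    rw [← mul_one a, ← smul_eq_mul, Submodule.Quotient.mk_smul]
    exact Submodule.smul_mem _ _ (Submodule.subset_span
      ⟨_, Submodule.mem_span_singleton_self _, rfl⟩)
  obtain ⟨r, hr⟩ := Submodule.mem_span_singleton.1 (h.gen₁.mem_of_coe_mem_span _ ⟨q, hq⟩ hspan)
  obtain ⟨X, hX, rfl⟩ := cls_surjective r
  exact ⟨X, hX, by rw [← cls_smul_oneVec h.subset hX, hr]⟩

theorem locNil_whi (h : IsTwoStage k T₁ T₂ T₀) {V : Type*} [AddCommGroup V] [Module A V]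
    (hV : LocNil T₂ V) : LocNil T₀ (whi T₁ V) := by
  intro x hx v
  obtain ⟨t, ht, rfl⟩ := (h.mem_iff x).1 hx
  obtain ⟨n, hn⟩ := hV t ht v
  exact ⟨n, Subtype.ext (by rw [cls_pow_smul_coe, hn]; rfl)⟩

theorem locNil_ind (h : IsTwoStage k T₁ T₂ T₀) {W : Type u} [AddCommGroup W]
    [Module (Reduction k T₁) W] (hW : LocNil T₀ W) : LocNil T₂ (ind k T₁ W) := by
  intro t ht x
  induction x using ind_induction with
  | zero => exact zero_mem _
  | add x y hx hy => exact add_mem hx hy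
  | smul a w =>
    refine h.smul_mem_nilVectors _ t ht _ ?_ a
    obtain ⟨n, hn⟩ := hW _ (h.cls_mem ht) w
    refine ⟨n, ?_⟩
    rw [← cls_pow_smul_coe (h.mem_normalizer t ht), ← map_smul, hn, map_zero]
    rfl

theorem gen₀ (h : IsTwoStage k T₁ T₂ T₀) : IsProjectiveGenerator T₀ where
  locNil := by
    refine (h.locNil_whi h.gen₂.locNil).of_injective (whiHom ⟨_, h.oneVec_mem⟩) ?_
    rw [injective_iff_map_eq_zero]
    intro q hq
    obtain ⟨r, rfl⟩ := Submodule.Quotient.mk_surjective _ q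
    obtain ⟨X, hX, rfl⟩ := cls_surjective r
    rw [Submodule.Quotient.mk_eq_zero, h.cls_mem_span_iff hX, ← Submodule.Quotient.mk_eq_zero,
      ← cls_smul_oneVec h.subset hX]
    exact congrArg Subtype.val hq
  exists_sub_mem V _ _ hV K v hv := by
    let N := K.map (indUnit k T₁ V)
    obtain ⟨w, hw, hvw⟩ := h.gen₂.exists_sub_mem (ind k T₁ V) (h.locNil_ind hV)
      (Submodule.span A ((↑) '' (N : Set (whi T₁ (ind k T₁ V))) : Set (ind k T₁ V)))
      (indUnit k T₁ V v) (fun t ht => Submodule.subset_span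
        ⟨_, ⟨_, hv _ (h.cls_mem ht), map_smul _ _ _⟩, rfl⟩)
    have hw₁ : w ∈ whi T₁ (ind k T₁ V) := by
      have := sub_mem (indUnit k T₁ V v).2 (h.whi_le hvw)
      rwa [sub_sub_cancel] at this
    obtain ⟨w₀, hw₀, hww₀⟩ := h.gen₁.mem_of_coe_mem_span N ⟨w, hw₁⟩ hw
    refine ⟨w₀, hw₀, fun x hx => h.gen₁.indUnit_injective (k := k) ?_⟩
    rw [map_smul, map_sub, hww₀, map_zero]
    exact (h.coe_mem_whi_iff (v := indUnit k T₁ V v - ⟨w, hw₁⟩)).1 hvw x hx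
  eq_zero V _ _ hV h₀ v := by
    refine h.gen₁.indUnit_injective (k := k) ((Subtype.ext ?_).trans (map_zero _).symm)
    refine h.gen₂.eq_zero (ind k T₁ V) (h.locNil_ind hV) (fun x hx => ?_) _
    obtain ⟨w, hw⟩ := h.gen₁.indUnit_surjective (k := k) (W := V) ⟨x, h.whi_le hx⟩
    have hw₀ : w = 0 := h₀ w fun t ht => h.gen₁.indUnit_injective (k := k) (by
      rw [map_smul, hw, (h.coe_mem_whi_iff (v := ⟨x, h.whi_le hx⟩)).1 hx t ht, map_zero])
    rw [hw₀, map_zero] at hw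
    exact (congrArg Subtype.val hw).symm

theorem cls_mem_normalizer_iff (h : IsTwoStage k T₁ T₂ T₀) {X : A} (h₁ : X ∈ normalizer k T₁) :
    cls k T₁ X h₁ ∈ normalizer k T₀ ↔ X ∈ normalizer k T₂ := by
  have key {t : A} (ht : t ∈ T₂) :
      ⁅cls k T₁ t (h.mem_normalizer t ht), cls k T₁ X h₁⁆ ∈ Ideal.span T₀ ↔
        ⁅t, X⁆ ∈ Ideal.span T₂ :=
    h.cls_mem_span_iff (sub_mem (mul_mem (h.mem_normalizer t ht) h₁)
      (mul_mem h₁ (h.mem_normalizer t ht)))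
  refine ⟨fun h₀ t ht => (key ht).1 (h₀ _ (h.cls_mem ht)), fun h₂ x hx => ?_⟩
  obtain ⟨t, ht, rfl⟩ := (h.mem_iff x).1 hx
  exact (key ht).2 (h₂ t ht)

variable (T₁ T₀) in
/-- The elements `X` of the normalizer of `T₁` whose class normalizes `T₀`. -/
def stageNormalizer : Subalgebra k (normalizer k T₁) :=
  (normalizer k T₀).comap (clsHom k T₁)

variable (T₁ T₀) in
/-- The homomorphism `X ↦ (X mod A T₁) mod I₀`, for `I₀` the left ideal generated by `T₀`. -/
def stageHom : stageNormalizer T₁ T₀ →ₐ[k] Reduction k T₀ :=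
  (clsHom k T₀).comp (((clsHom k T₁).comp (Subalgebra.val _)).codRestrict _ Subtype.property)

/-- The homomorphism `X ↦ X mod A T₂`. -/
def stageHom₂ (h : IsTwoStage k T₁ T₂ T₀) : stageNormalizer T₁ T₀ →ₐ[k] Reduction k T₂ :=
  (clsHom k T₂).comp (((Subalgebra.val _).comp (Subalgebra.val _)).codRestrict _
    fun X => (h.cls_mem_normalizer_iff X.1.2).1 X.2)

variable (T₁ T₀) in
theorem stageHom_surjective : Function.Surjective (stageHom T₁ T₀) := by
  intro r
  obtain ⟨x, h₀, rfl⟩ := cls_surjective r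
  obtain ⟨X, h₁, rfl⟩ := cls_surjective x
  exact ⟨⟨⟨X, h₁⟩, h₀⟩, rfl⟩

theorem stageHom₂_surjective (h : IsTwoStage k T₁ T₂ T₀) : Function.Surjective h.stageHom₂ := by
  intro r
  obtain ⟨X, h₂, rfl⟩ := cls_surjective r
  obtain ⟨X', h₁, hX'⟩ := h.exists_mk_eq (h.whi_le ((mk_mem_whi_iff k).2 h₂))
  have h₂' : X' ∈ normalizer k T₂ := by
    rwa [← mk_mem_whi_iff k, hX', mk_mem_whi_iff k]
  exact ⟨⟨⟨X', h₁⟩, (h.cls_mem_normalizer_iff h₁).2 h₂'⟩,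
    cls_eq_cls_iff.2 ((Submodule.Quotient.eq _).1 hX')⟩

theorem ker_stageHom (h : IsTwoStage k T₁ T₂ T₀) :
    RingHom.ker (stageHom T₁ T₀) = RingHom.ker h.stageHom₂ := by
  ext X
  refine clsHom_eq_zero_iff.trans ((h.cls_mem_span_iff X.1.2).trans (Iff.symm ?_))
  exact clsHom_eq_zero_iff

/-- The isomorphism `(X mod A T₁) mod I₀ ↦ X mod A T₂`. -/
def reductionEquiv (h : IsTwoStage k T₁ T₂ T₀) : Reduction k T₀ ≃ₐ[k] Reduction k T₂ :=
  algEquivOfKerEq (stageHom_surjective T₁ T₀) h.stageHom₂_surjective h.ker_stageHom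

theorem reductionEquiv_cls (h : IsTwoStage k T₁ T₂ T₀) {X : A} (h₁ : X ∈ normalizer k T₁)
    (h₀ : cls k T₁ X h₁ ∈ normalizer k T₀) :
    h.reductionEquiv (cls k T₀ (cls k T₁ X h₁) h₀) =
      cls k T₂ X ((h.cls_mem_normalizer_iff h₁).1 h₀) :=
  algEquivOfKerEq_apply _ _ h.ker_stageHom ⟨⟨X, h₁⟩, h₀⟩

theorem whittaker_le (h : IsTwoStage k T₁ T₂ T₀) : whittaker T₂ ≤ whittaker T₁ :=
  fun _ hV => ⟨hV.1, fun t ht => hV.2 t (h.subset ht)⟩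

theorem restrictToEquivalence₁ (h : IsTwoStage k T₁ T₂ T₀) :
    RestrictToEquivalence (Whi k T₁) (Ind k T₁) (whittaker T₂) (whittaker T₀) := by
  refine RestrictToEquivalence.of_natTrans (fun V hV => ?_) (fun W hW => ?_) (whiIndUnit k T₁)
    (whiIndCounit k T₁) (fun W _ => h.gen₁.isIso_unit W)
    fun V hV => h.gen₁.isIso_counit ((whittaker_iff.1 hV).2.mono h.subset)
  · rw [whittaker_iff] at hV
    have := hV.1
    exact whittaker_iff.2 ⟨h.gen₁.whi_finite k (hV.2.mono h.subset), h.locNil_whi hV.2⟩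
  · rw [whittaker_iff] at hW
    have := hW.1
    exact whittaker_iff.2 ⟨ind_finite k T₁ W, h.locNil_ind hW.2⟩

section WhiWhi

variable [Algebra ℂ A] {T₀ : Set (Reduction ℂ T₁)}

/-- The vectors killed by `T₂` are the vectors killed by `T₀` among those killed by `T₁`. -/
def whiWhiEquiv (h : IsTwoStage ℂ T₁ T₂ T₀) (V : ModuleCat.{u} A) :
    (Whi ℂ T₁ ⋙ WhiVia T₀ h.reductionEquiv).obj V ≃ₗ[Reduction ℂ T₂] (Whi ℂ T₂).obj V where
  toFun v := (⟨_, h.coe_mem_whi_iff.2 v.2⟩ : whi T₂ V)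
  invFun v := (⟨⟨v.1, h.whi_le v.2⟩, h.coe_mem_whi_iff.1 v.2⟩ : whi T₀ (whi T₁ V))
  left_inv _ := rfl
  right_inv _ := rfl
  map_add' _ _ := rfl
  map_smul' r v := by
    obtain ⟨r, rfl⟩ := h.reductionEquiv.surjective r
    obtain ⟨x, h₀, rfl⟩ := cls_surjective r
    obtain ⟨X, h₁, rfl⟩ := cls_surjective x
    have e : (h.reductionEquiv (cls ℂ T₀ _ h₀) • v) =
        (cls ℂ T₀ (cls ℂ T₁ X h₁) h₀ • (show whi T₀ (whi T₁ V) from v) : whi T₀ (whi T₁ V)) :=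
      congrArg (fun r : Reduction ℂ T₀ => r • (show whi T₀ (whi T₁ V) from v))
        (h.reductionEquiv.symm_apply_apply _)
    rw [e, h.reductionEquiv_cls]
    rfl

/-- Taking the vectors killed by `T₂` is the composition of the two stages. -/
def whiWhiIso (h : IsTwoStage ℂ T₁ T₂ T₀) :
    (whittaker T₂).ι ⋙ Whi ℂ T₁ ⋙ WhiVia T₀ h.reductionEquiv ≅ (whittaker T₂).ι ⋙ Whi ℂ T₂ :=
  NatIso.ofComponents fun V => (h.whiWhiEquiv V.obj).toModuleIso

theorem whiWhiIso_apply (h : IsTwoStage ℂ T₁ T₂ T₀) (V : (whittaker T₂).FullSubcategory)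
    (v : whi T₀ (whi T₁ V.obj)) :
    (whi T₂ V.obj).subtype ((h.whiWhiIso.hom.app V).hom v) = ((v : whi T₁ V.obj) : V.obj) :=
  rfl

end WhiWhi

end IsTwoStage

end TwoStages

section Engel

variable {K A V ι : Type*} [CommRing K] [Ring A] [Algebra K A] [AddCommGroup V] [Module A V]
  [Module K V] [IsScalarTower K A V]

variable (K) in
/-- A family `t` of elements of degrees `- e i < 0` whose commutators are combinations of members of
the family, of degree smaller than the sum of the degrees. -/
structure IsGradedFamily (t : ι → A) (e : ι → ℤ) : Prop where
  pos : ∀ i, 0 < e i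
  lie_mem_span : ∀ i j, ⁅t i, t j⁆ ∈ Submodule.span K (t '' {l | e i + e j < e l})

theorem smul_mem_of_mem_span {t : Set A} {P : Submodule K V} {v : V} (hv : ∀ a ∈ t, a • v ∈ P)
    {a : A} (ha : a ∈ Submodule.span K t) : a • v ∈ P := by
  induction ha using Submodule.span_induction with
  | mem a ha => exact hv a ha
  | zero => rw [zero_smul]; exact zero_mem P
  | add a b _ _ ha hb => rw [add_smul]; exact add_mem ha hb
  | smul c a _ ha => rw [smul_assoc]; exact P.smul_mem c ha

namespace IsGradedFamily

variable {t : ι → A} {e : ι → ℤ}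

theorem lie_smul_mem (h : IsGradedFamily K t e) {P : Submodule K V} {v : V} {i j : ι}
    (hv : ∀ l, e i + e j < e l → t l • v ∈ P) : ⁅t i, t j⁆ • v ∈ P :=
  smul_mem_of_mem_span (Set.forall_mem_image.2 hv) (h.lie_mem_span i j)

theorem smul_pow_smul_mem (h : IsGradedFamily K t e) {S : Submodule K V}
    (hS : ∀ i, ∀ v ∈ S, t i • v ∈ S) {s : Finset ι} {a : ι}
    (hs : ∀ i ∈ s, ∀ l, e i + e a < e l → l ∈ s) {v : V} (hv : ∀ i ∈ s, t i • v ∈ S) (k : ℕ) :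
    ∀ i ∈ s, t i • t a ^ k • v ∈ S := by
  induction k with
  | zero => simpa only [pow_zero, one_smul] using hv
  | succ k ih =>
    intro i hi
    rw [pow_succ', mul_smul, smul_smul_eq_add_lie_smul]
    exact add_mem (hS a _ (ih i hi)) (h.lie_smul_mem fun l hl => ih l (hs i hi l hl))

variable [Finite ι]

theorem exists_notMem (h : IsGradedFamily K t e) (hV : LocNil (Set.range t) V) (S : Submodule K V)
    (hS : ∀ i, ∀ v ∈ S, t i • v ∈ S) {v₀ : V} (hv₀ : v₀ ∉ S) :
    ∃ v, v ∉ S ∧ ∀ i, t i • v ∈ S := by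
  classical
  have := Fintype.ofFinite ι
  suffices ∀ s : Finset ι, (∀ i ∈ s, ∀ l, e i < e l → l ∈ s) →
      ∃ v, v ∉ S ∧ ∀ i ∈ s, t i • v ∈ S by
    obtain ⟨v, hv, hv'⟩ := this Finset.univ fun _ _ _ _ => Finset.mem_univ _
    exact ⟨v, hv, fun i => hv' i (Finset.mem_univ i)⟩
  intro s
  induction s using Finset.induction_on_min_value e with
  | empty => exact fun _ => ⟨v₀, hv₀, fun i hi => absurd hi (Finset.notMem_empty i)⟩
  | insert a s _ hmin ih =>
    intro hs
    have hs' : ∀ i ∈ s, ∀ l, e i < e l → l ∈ s := fun i hi l hl =>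
      (Finset.mem_insert.1 (hs i (Finset.mem_insert_of_mem hi) l hl)).resolve_left
        (by rintro rfl; exact not_le.2 hl (hmin i hi))
    obtain ⟨v, hv, hvs⟩ := ih hs'
    have hpow := h.smul_pow_smul_mem (a := a) hS
      (fun i hi l hl => hs' i hi l (by have := h.pos a; omega)) hvs
    obtain ⟨k, hk, hk'⟩ : ∃ k, t a ^ k • v ∉ S ∧ t a ^ (k + 1) • v ∈ S := by
      by_contra! hk
      obtain ⟨j, hj⟩ := hV _ ⟨a, rfl⟩ v
      have hnot (k : ℕ) : t a ^ k • v ∉ S := by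
        induction k with
        | zero => simpa only [pow_zero, one_smul] using hv
        | succ k ih => exact hk k ih
      exact hnot j (hj ▸ zero_mem S)
    refine ⟨t a ^ k • v, hk, fun i hi => ?_⟩
    rcases Finset.mem_insert.1 hi with rfl | hi
    · rwa [← mul_smul, ← pow_succ']
    · exact hpow k i hi

theorem exists_ne_zero (h : IsGradedFamily K t e) (hV : LocNil (Set.range t) V) {v : V}
    (hv : v ≠ 0) : ∃ w : V, w ≠ 0 ∧ ∀ i, t i • w = 0 :=
  h.exists_notMem hV ⊥
    (fun i v hv => by rw [(Submodule.mem_bot K).1 hv, smul_zero]; exact zero_mem _)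
    (mt (Submodule.mem_bot K).1 hv)

end IsGradedFamily

variable (K V) in
/-- The vectors that are killed by all products of `k` members of the family `t`. -/
def annihilated (t : ι → A) : ℕ → Submodule K V
  | 0 => ⊥
  | k + 1 => ⨅ i, (annihilated t k).comap (Algebra.lsmul K K V (t i))

theorem mem_annihilated_succ {t : ι → A} {k : ℕ} {v : V} :
    v ∈ annihilated K V t (k + 1) ↔ ∀ i, t i • v ∈ annihilated K V t k := by
  simp [annihilated]

theorem annihilated_mono (t : ι → A) : Monotone (annihilated K V t) := by
  refine monotone_nat_of_le_succ fun k => ?_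
  induction k with
  | zero => exact bot_le
  | succ k ih => exact fun v hv => mem_annihilated_succ.2 fun i => ih (mem_annihilated_succ.1 hv i)

theorem IsGradedFamily.exists_mem_annihilated [Finite ι] {t : ι → A} {e : ι → ℤ}
    (h : IsGradedFamily K t e) (hV : LocNil (Set.range t) V) (v : V) :
    ∃ k, v ∈ annihilated K V t k := by
  have := Fintype.ofFinite ι
  have mem_iSup {w : V} : w ∈ ⨆ k, annihilated K V t k ↔ ∃ k, w ∈ annihilated K V t k :=
    Submodule.mem_iSup_of_directed _ (annihilated_mono t).directed_le
  by_contra hv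
  obtain ⟨w, hw, hw'⟩ := h.exists_notMem hV (⨆ k, annihilated K V t k) (fun i w hw => by
    obtain ⟨k, hk⟩ := mem_iSup.1 hw
    exact mem_iSup.2 ⟨k, mem_annihilated_succ.1 (annihilated_mono t k.le_succ hk) i⟩)
    (mt mem_iSup.1 hv)
  choose k hk using fun i => mem_iSup.1 (hw' i)
  exact hw (mem_iSup.2 ⟨Finset.univ.sup k + 1, mem_annihilated_succ.2 fun i =>
    annihilated_mono t (Finset.le_sup (Finset.mem_univ i)) (hk i)⟩)

end Engel

section Filtration

variable {K A V : Type*} [CommRing K] [Ring A] [Algebra K A] [AddCommGroup V] [Module A V]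
  [Module K V] [IsScalarTower K A V]

variable (A) in
/-- The elements of `A` that raise the degree by at most `e`, for a filtration `F` of a module. -/
def opsLE (F : ℤ → Submodule K V) (e : ℤ) : Submodule K A where
  carrier := {a | ∀ d, ∀ v ∈ F d, a • v ∈ F (d + e)}
  zero_mem' := fun d v _ => by rw [zero_smul]; exact zero_mem _
  add_mem' := fun ha hb d v hv => by rw [add_smul]; exact add_mem (ha d v hv) (hb d v hv)
  smul_mem' := fun c a ha d v hv => by rw [smul_assoc]; exact Submodule.smul_mem _ _ (ha d v hv)

variable {F : ℤ → Submodule K V} {e e' : ℤ} {a b : A}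

theorem opsLE_mono (hF : Monotone F) : Monotone (opsLE A F) :=
  fun _ _ he _ ha d v hv => hF (by omega) (ha d v hv)

theorem smul_mem_of_mem_opsLE (hF : Monotone F) (ha : a ∈ opsLE A F e) {d d' : ℤ} {v : V}
    (hv : v ∈ F d) (hd : d + e ≤ d') : a • v ∈ F d' :=
  hF hd (ha d v hv)

theorem mul_mem_opsLE (ha : a ∈ opsLE A F e) (hb : b ∈ opsLE A F e') :
    a * b ∈ opsLE A F (e + e') := by
  intro d v hv
  rw [mul_smul, add_comm e, ← add_assoc]
  exact ha _ _ (hb d v hv)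

theorem pow_mem_opsLE (ha : a ∈ opsLE A F e) (k : ℕ) : a ^ k ∈ opsLE A F (k * e) := by
  induction k with
  | zero => intro d v hv; simpa using hv
  | succ k ih =>
    rw [pow_succ, Nat.cast_succ, add_one_mul]
    exact mul_mem_opsLE ih ha

theorem lie_mul_eq (s a b : A) : ⁅s, a * b⁆ = ⁅s, a⁆ * b + a * ⁅s, b⁆ := by
  simp only [Ring.lie_def]
  noncomm_ring

theorem lie_pow_sub_smul_mem_opsLE (hF : Monotone F) {p q : ℤ} {s z : A} {c : K}
    (hz : z ∈ opsLE A F q) (hsz : ⁅s, z⁆ - algebraMap K A c ∈ opsLE A F (q - p - 1)) (k : ℕ) :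
    ⁅s, z ^ k⁆ - (k * c) • z ^ (k - 1) ∈ opsLE A F (k * q - p - 1) := by
  induction k with
  | zero => simp [Ring.lie_def]
  | succ k ih =>
    have hpow : (k * c) • z ^ (k - 1) * z = (k * c) • z ^ k := by
      cases k with
      | zero => simp
      | succ k => rw [smul_mul_assoc, Nat.add_sub_cancel, ← pow_succ]
    have hlie : ⁅s, z ^ (k + 1)⁆ - ((k + 1 : ℕ) * c) • z ^ k =
        (⁅s, z ^ k⁆ - (k * c) • z ^ (k - 1)) * z + z ^ k * (⁅s, z⁆ - algebraMap K A c) := by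
      rw [pow_succ, lie_mul_eq, sub_mul, hpow, mul_sub, ← Algebra.commutes, ← Algebra.smul_def,
        Nat.cast_succ, add_one_mul, add_smul]
      abel
    rw [Nat.add_sub_cancel, hlie]
    exact add_mem (opsLE_mono hF (by push_cast; linarith) (mul_mem_opsLE ih hz))
      (opsLE_mono hF (by push_cast; linarith) (mul_mem_opsLE (pow_mem_opsLE hz k) hsz))

theorem lie_pow_mul_pow_mem_opsLE (hF : Monotone F) {p q : ℤ} {s z t : A} {c : K}
    (hz : z ∈ opsLE A F q) (ht : t ∈ opsLE A F (-q))
    (hsz : ⁅s, z⁆ - algebraMap K A c ∈ opsLE A F (q - p - 1))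
    (hst : ⁅s, t⁆ ∈ opsLE A F (-q - p - 1)) (k : ℕ) :
    ⁅s, z ^ (k + 1) * t ^ k⁆ - ((k + 1 : ℕ) * c) • (z ^ k * t ^ k) ∈ opsLE A F (q - p - 1) := by
  have hsz' := lie_pow_sub_smul_mem_opsLE hF hz hsz (k + 1)
  have hst' := lie_pow_sub_smul_mem_opsLE hF (c := 0) ht (by simpa using hst) k
  rw [mul_zero, zero_smul, sub_zero] at hst'
  rw [lie_mul_eq, add_sub_right_comm, ← smul_mul_assoc, ← sub_mul]
  exact add_mem
    (opsLE_mono hF (by push_cast; linarith) (mul_mem_opsLE hsz' (pow_mem_opsLE ht k)))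
    (opsLE_mono hF (by push_cast; linarith) (mul_mem_opsLE (pow_mem_opsLE hz (k + 1)) hst'))

end Filtration

section Heisenberg

variable {K A V : Type*} [Field K] [Ring A] [Algebra K A] [AddCommGroup V] [Module A V]
  [Module K V] [IsScalarTower K A V]

variable (K) in
/-- The partial sums of the antiderivative in `x` of `exp (- x y)` at `x = 0`, in the normal order
`x = z`, `y = t`. -/
def homotopy (z t : A) (N : ℕ) : A :=
  ∑ k ∈ Finset.range N, ((-1) ^ k / (k + 1).factorial : K) • (z ^ (k + 1) * t ^ k)

variable (K) in
/-- The partial sums of the normally ordered exponential `:exp (- z t):`, which is the projection to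
the kernel of `t` if `⁅t, z⁆ = 1` and `t` is locally nilpotent. -/
def normalExp (z t : A) (N : ℕ) : A :=
  ∑ k ∈ Finset.range N, ((-1) ^ k / k.factorial : K) • (z ^ k * t ^ k)

variable {z t : A} {N : ℕ}

theorem homotopy_mul : homotopy K z t N * t = 1 - normalExp K z t (N + 1) := by
  rw [normalExp, Finset.sum_range_succ', homotopy, Finset.sum_mul, sub_add_eq_sub_sub_swap]
  have hterm (k : ℕ) : ((-1) ^ k / (k + 1).factorial : K) • (z ^ (k + 1) * t ^ k) * t =
      -(((-1) ^ (k + 1) / (k + 1).factorial : K) • (z ^ (k + 1) * t ^ (k + 1))) := by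
    rw [smul_mul_assoc, mul_assoc, ← pow_succ, ← neg_smul, pow_succ (-1 : K), mul_neg_one, neg_div,
      neg_neg]
  simp [hterm]

theorem normalExp_succ_smul {v : V} (hv : t ^ N • v = 0) :
    normalExp K z t (N + 1) • v = normalExp K z t N • v := by
  rw [normalExp, Finset.sum_range_succ, add_smul, smul_assoc, mul_smul, hv, smul_zero, smul_zero,
    add_zero, normalExp]

variable {F : ℤ → Submodule K V} {p q : ℤ} {s : A}

theorem homotopy_mem_opsLE (hF : Monotone F) (hz : z ∈ opsLE A F q) (ht : t ∈ opsLE A F (-q)) :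
    homotopy K z t N ∈ opsLE A F q :=
  sum_mem fun k _ => Submodule.smul_mem _ _ <| opsLE_mono hF (by push_cast; linarith) <|
    mul_mem_opsLE (pow_mem_opsLE hz (k + 1)) (pow_mem_opsLE ht k)

theorem lie_homotopy_mem_opsLE [CharZero K] (hF : Monotone F) {c : K} (hz : z ∈ opsLE A F q)
    (ht : t ∈ opsLE A F (-q)) (hsz : ⁅s, z⁆ - algebraMap K A c ∈ opsLE A F (q - p - 1))
    (hst : ⁅s, t⁆ ∈ opsLE A F (-q - p - 1)) :
    ⁅s, homotopy K z t N⁆ - c • normalExp K z t N ∈ opsLE A F (q - p - 1) := by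
  have hsum : ⁅s, homotopy K z t N⁆ - c • normalExp K z t N =
      ∑ k ∈ Finset.range N, ((-1) ^ k / (k + 1).factorial : K) •
        (⁅s, z ^ (k + 1) * t ^ k⁆ - ((k + 1 : ℕ) * c) • (z ^ k * t ^ k)) := by
    rw [homotopy, normalExp, Ring.lie_def, Finset.mul_sum, Finset.sum_mul, Finset.smul_sum,
      ← Finset.sum_sub_distrib, ← Finset.sum_sub_distrib]
    refine Finset.sum_congr rfl fun k _ => ?_
    have hcoeff : c * ((-1) ^ k / k.factorial : K) =
        (-1) ^ k / (k + 1).factorial * ((k + 1 : ℕ) * c) := by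
      have := Nat.cast_ne_zero (R := K).2 k.succ_ne_zero
      have := Nat.cast_ne_zero (R := K).2 k.factorial_ne_zero
      rw [Nat.factorial_succ, Nat.cast_mul]
      field_simp
    rw [mul_smul_comm, smul_mul_assoc, ← smul_sub, ← Ring.lie_def, smul_smul, hcoeff, ← smul_smul,
      ← smul_sub]
  rw [hsum]
  exact sum_mem fun k _ => Submodule.smul_mem _ _ (lie_pow_mul_pow_mem_opsLE hF hz ht hsz hst k)

variable {ι : Type*} [DecidableEq ι]

/-- Elements `t i` and `z i` of degrees `- e i` and `e i` with respect to a filtration `F` of a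
module, which satisfy the relations `⁅t i, z j⁆ = δ i j` and `⁅t i, t j⁆ = 0` of a Heisenberg
algebra up to terms of lower degree. -/
structure IsApproxHeisenberg (F : ℤ → Submodule K V) (t z : ι → A) (e : ι → ℤ) : Prop extends
    IsGradedFamily K t e where
  mono : Monotone F
  eq_bot : ∀ d < 0, F d = ⊥
  t_mem : ∀ i, t i ∈ opsLE A F (-e i)
  z_mem : ∀ i, z i ∈ opsLE A F (e i)
  lie_z_mem : ∀ i j, ⁅t i, z j⁆ - algebraMap K A (if i = j then 1 else 0) ∈
    opsLE A F (e j - e i - 1)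

namespace IsApproxHeisenberg

variable {t z : ι → A} {e : ι → ℤ} {d : ℤ} {u : V}

theorem lie_t_mem (h : IsApproxHeisenberg F t z e) (i j : ι) :
    ⁅t i, t j⁆ ∈ opsLE A F (-e j - e i - 1) := by
  refine Submodule.span_le.2 (Set.forall_mem_image.2 fun l (hl : e i + e j < e l) => ?_)
    (h.lie_mem_span i j)
  exact opsLE_mono h.mono (by omega) (h.t_mem l)

theorem pow_smul_eq_zero (h : IsApproxHeisenberg F t z e) (r : ι) {d : ℤ} {u : V} (hu : u ∈ F d) :
    ∃ N : ℕ, t r ^ N • u = 0 := by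
  refine ⟨d.toNat + 1, (Submodule.mem_bot K).1 ?_⟩
  rw [← h.eq_bot (-1) (by omega)]
  refine smul_mem_of_mem_opsLE h.mono (pow_mem_opsLE (h.t_mem r) _) hu ?_
  have := h.pos r
  push_cast
  nlinarith [Int.self_le_toNat d, Int.natCast_nonneg d.toNat]

variable [CharZero K]

theorem lie_homotopy_mem (h : IsApproxHeisenberg F t z e) (i r : ι) (N : ℕ) :
    ⁅t i, homotopy K (z r) (t r) N⁆ - (if i = r then 1 else 0 : K) • normalExp K (z r) (t r) N ∈
      opsLE A F (e r - e i - 1) :=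
  lie_homotopy_mem_opsLE h.mono (h.z_mem r) (h.t_mem r) (h.lie_z_mem i r) (h.lie_t_mem i r)

theorem smul_homotopy_smul_sub_mem (h : IsApproxHeisenberg F t z e) {r : ι} {N : ℕ}
    (hu : u ∈ F (d - e r)) (hN : t r ^ N • u = 0) :
    t r • homotopy K (z r) (t r) N • u - u ∈ F (d - e r - 1) := by
  have hlie := h.lie_homotopy_mem r r N
  rw [if_pos rfl, one_smul] at hlie
  have heq : t r • homotopy K (z r) (t r) N • u - u =
      (⁅t r, homotopy K (z r) (t r) N⁆ - normalExp K (z r) (t r) N) • u := by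
    rw [smul_smul_eq_add_lie_smul, ← mul_smul, homotopy_mul, sub_smul, sub_smul, one_smul,
      normalExp_succ_smul hN]
    abel
  rw [heq]
  exact smul_mem_of_mem_opsLE h.mono hlie hu (by omega)

theorem smul_homotopy_smul_mem (h : IsApproxHeisenberg F t z e) {i r : ι} (hir : i ≠ r) {N : ℕ}
    (hu : u ∈ F (d - e r)) (hiu : t i • u ∈ F (d - e r - e i - 1)) :
    t i • homotopy K (z r) (t r) N • u ∈ F (d - e i - 1) := by
  have hlie := h.lie_homotopy_mem i r N
  rw [if_neg hir, zero_smul, sub_zero] at hlie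
  rw [smul_smul_eq_add_lie_smul]
  have hmem := homotopy_mem_opsLE h.mono (h.z_mem r) (h.t_mem r) (N := N)
  exact add_mem (smul_mem_of_mem_opsLE h.mono hmem hiu (by omega))
    (smul_mem_of_mem_opsLE h.mono hlie hu (by omega))

variable {P : Submodule A V} {v : V}

theorem exists_improvement (h : IsApproxHeisenberg F t z e) (hvP : ∀ i, t i • v ∈ P)
    (hv : ∀ i, t i • v ∈ F (d - e i)) (s : Finset ι) :
    ∃ w ∈ P, (∀ i, t i • (v - w) ∈ F (d - e i)) ∧ ∀ i ∈ s, t i • (v - w) ∈ F (d - e i - 1) := by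
  induction s using Finset.induction_on with
  | empty => exact ⟨0, zero_mem P, by simpa using hv, by simp⟩
  | insert r s _ ih =>
    obtain ⟨w, hw, hwd, hws⟩ := ih
    obtain ⟨N, hN⟩ := h.pow_smul_eq_zero r (hwd r)
    set u := t r • (v - w) with hu
    set w' := homotopy K (z r) (t r) N • u
    have hw' : w' ∈ F d := smul_mem_of_mem_opsLE h.mono
      (homotopy_mem_opsLE h.mono (h.z_mem r) (h.t_mem r)) (hwd r) (by omega)
    refine ⟨w + w', add_mem hw (P.smul_mem _ ?_), fun i => ?_, fun i hi => ?_⟩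
    · rw [hu, smul_sub]
      exact sub_mem (hvP r) (P.smul_mem _ hw)
    · rw [← sub_sub, smul_sub]
      exact sub_mem (hwd i) (smul_mem_of_mem_opsLE h.mono (h.t_mem i) hw' (by omega))
    · rw [← sub_sub, smul_sub]
      rcases eq_or_ne i r with rfl | hir
      · rw [← neg_sub (t i • w')]
        exact neg_mem (h.smul_homotopy_smul_sub_mem (hwd i) hN)
      · have his := hws i ((Finset.mem_insert.1 hi).resolve_left hir)
        refine sub_mem his (h.smul_homotopy_smul_mem hir (hwd r) ?_)
        rw [hu, smul_smul_eq_add_lie_smul]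
        exact add_mem (smul_mem_of_mem_opsLE h.mono (h.t_mem r) his (by omega))
          (h.lie_smul_mem fun l hl => h.mono (by omega) (hwd l))

theorem exists_sub_eq_zero [Finite ι] (h : IsApproxHeisenberg F t z e) {d : ℕ} (hvd : v ∈ F d)
    (hvP : ∀ i, t i • v ∈ P) : ∃ w ∈ P, ∀ i, t i • (v - w) = 0 := by
  have := Fintype.ofFinite ι
  replace hvd (i : ι) : t i • v ∈ F (d - e i) :=
    smul_mem_of_mem_opsLE h.mono (h.t_mem i) hvd (by omega)
  induction d generalizing v with
  | zero =>
    refine ⟨0, zero_mem P, fun i => (Submodule.mem_bot K).1 ?_⟩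
    rw [← h.eq_bot (-e i) (by have := h.pos i; omega)]
    simpa using hvd i
  | succ d ih =>
    obtain ⟨w, hw, -, hwd⟩ := h.exists_improvement hvP hvd Finset.univ
    obtain ⟨w', hw', hv⟩ := ih (v := v - w)
      (fun i => by rw [smul_sub]; exact sub_mem (hvP i) (P.smul_mem _ hw))
      fun i => h.mono (by push_cast; omega) (hwd i (Finset.mem_univ i))
    exact ⟨w + w', add_mem hw hw', fun i => by rw [← sub_sub]; exact hv i⟩

end IsApproxHeisenberg

end Heisenberg

section Adapted

variable {K g A ι : Type*} [Field K] [LieRing g] [LieAlgebra K g] [Ring A] [Algebra K A]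

/-- The linear map `a ↦ φ(a) - χ(a)`. -/
def shiftMap (φ : g →ₗ[K] A) (χ : Module.Dual K g) : g →ₗ[K] A :=
  φ - Algebra.linearMap K A ∘ₗ χ

variable {φ : g →ₗ[K] A} {χ : Module.Dual K g}

theorem shiftMap_apply (a : g) : shiftMap φ χ a = φ a - algebraMap K A (χ a) :=
  rfl

theorem shiftMap_eq_self {a : g} (ha : χ a = 0) : shiftMap φ χ a = φ a := by
  rw [shiftMap_apply, ha, map_zero, sub_zero]

theorem lie_shiftMap (hφ : ∀ a b, φ ⁅a, b⁆ = ⁅φ a, φ b⁆) (a b : g) :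
    ⁅shiftMap φ χ a, φ b⁆ = φ ⁅a, b⁆ := by
  rw [shiftMap_apply, hφ, Ring.lie_def, Ring.lie_def, sub_mul, mul_sub, Algebra.commutes,
    sub_sub_sub_cancel_right]

theorem lie_shiftMap_shiftMap (hφ : ∀ a b, φ ⁅a, b⁆ = ⁅φ a, φ b⁆) {a b : g} (hab : χ ⁅a, b⁆ = 0) :
    ⁅shiftMap φ χ a, shiftMap φ χ b⁆ = shiftMap φ χ ⁅a, b⁆ := by
  rw [shiftMap_eq_self hab, ← lie_shiftMap (χ := χ) hφ, Ring.lie_def, Ring.lie_def,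
    shiftMap_apply b, sub_mul, mul_sub, Algebra.commutes, sub_sub_sub_cancel_right]

/-- A linear form `χ` of degree `-2` on a graded Lie algebra, and a subalgebra `m` that contains the
components of degree at least `2` and on which `χ` is a character. -/
structure IsGradedCharacter (Γ : ℤ → Submodule K g) (χ : Module.Dual K g) (m : LieSubalgebra K g) :
    Prop where
  lie_mem : ∀ i j, ∀ a ∈ Γ i, ∀ b ∈ Γ j, ⁅a, b⁆ ∈ Γ (i + j)
  grade_le : ∀ i, 2 ≤ i → Γ i ≤ m.toSubmodule
  char_eq_zero : ∀ i, i ≠ 2 → ∀ a ∈ Γ i, χ a = 0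
  char_lie : ∀ a ∈ m, ∀ b ∈ m, χ ⁅a, b⁆ = 0

variable {Γ : ℤ → Submodule K g} {m : LieSubalgebra K g}

variable [DecidableEq ι]

/-- A homogeneous basis `x` of `m`, with degrees `n i ≥ 1`, and homogeneous elements `z` which are
dual to it for the pairing `χ ⁅a, b⁆`. -/
structure IsDualFamily (Γ : ℤ → Submodule K g) (χ : Module.Dual K g) (x : Module.Basis ι K m)
    (z : ι → g) (n : ι → ℤ) : Prop where
  one_le : ∀ i, 1 ≤ n i
  x_mem : ∀ i, (x i : g) ∈ Γ (n i)
  z_mem : ∀ i, z i ∈ Γ (2 - n i)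
  dual : ∀ i j, χ ⁅(x i : g), z j⁆ = if i = j then 1 else 0

variable {x : Module.Basis ι K m} {z : ι → g} {n : ι → ℤ}

theorem IsDualFamily.repr_eq (hx : IsDualFamily Γ χ x z n) (a : m) (i : ι) :
    x.repr a i = χ ⁅(a : g), z i⁆ := by
  have h : x.coord i = -(χ ∘ₗ (LieAlgebra.ad K g (z i) : g →ₗ[K] g) ∘ₗ m.toSubmodule.subtype) := by
    refine x.ext fun j => ?_
    have hdual : -χ ⁅z i, (x j : g)⁆ = if j = i then 1 else 0 := by
      rw [← map_neg, lie_skew, hx.dual]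
    rw [Module.Basis.coord_apply, Module.Basis.repr_self, Finsupp.single_apply]
    exact hdual.symm
  refine (LinearMap.congr_fun h a).trans ?_
  rw [← lie_skew, map_neg]
  rfl

variable [Finite ι]

theorem IsDualFamily.mem_span (h : IsGradedCharacter Γ χ m) (hx : IsDualFamily Γ χ x z n) {j : ℤ}
    {a : g} (ha : a ∈ m) (haj : a ∈ Γ j) :
    a ∈ Submodule.span K ((fun i => (x i : g)) '' {i | n i = j}) := by
  cases nonempty_fintype ι
  have hsum : a = ∑ i, χ ⁅a, z i⁆ • (x i : g) := by
    have := congrArg (m.toSubmodule.subtype) (x.sum_repr ⟨a, ha⟩)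
    simp only [hx.repr_eq, map_sum, map_smul] at this
    exact this.symm
  rw [hsum]
  refine sum_mem fun i _ => ?_
  by_cases hi : n i = j
  · exact Submodule.smul_mem _ _ (Submodule.subset_span ⟨i, hi, rfl⟩)
  · rw [h.char_eq_zero _ _ _ (h.lie_mem _ _ a haj _ (hx.z_mem i)), zero_smul]
    · exact zero_mem _
    · omega

theorem IsDualFamily.shiftMap_mem_span (h : IsGradedCharacter Γ χ m) (hx : IsDualFamily Γ χ x z n)
    {j : ℤ} {a : g} (ha : a ∈ m) (haj : a ∈ Γ j) :
    shiftMap φ χ a ∈ Submodule.span K ((fun i => shiftMap φ χ (x i)) '' {i | n i = j}) := by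
  have := Submodule.mem_map_of_mem (f := shiftMap φ χ) (hx.mem_span h ha haj)
  rwa [Submodule.map_span, Set.image_image] at this

theorem IsDualFamily.isGradedFamily (hφ : ∀ a b, φ ⁅a, b⁆ = ⁅φ a, φ b⁆)
    (h : IsGradedCharacter Γ χ m) (hx : IsDualFamily Γ χ x z n) :
    IsGradedFamily K (fun i => shiftMap φ χ (x i)) (fun i => 2 * n i - 1) where
  pos i := by have := hx.one_le i; omega
  lie_mem_span i j := by
    rw [lie_shiftMap_shiftMap hφ (h.char_lie _ (x i).2 _ (x j).2)]
    refine Submodule.span_mono (Set.image_mono fun l (hl : n l = n i + n j) => ?_)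
      (hx.shiftMap_mem_span h (m.lie_mem (x i).2 (x j).2)
        (h.lie_mem _ _ _ (hx.x_mem i) _ (hx.x_mem j)))
    change 2 * n i - 1 + (2 * n j - 1) < 2 * n l - 1
    omega

end Adapted

section Kazhdan

variable {K g A V ι : Type*} [Field K] [LieRing g] [LieAlgebra K g] [Ring A] [Algebra K A]
  [AddCommGroup V] [Module A V] [Module K V] [IsScalarTower K A V]

/-- The vectors of degree at most `d`, for the filtration of `V` in which the elements of `Γ j` with
`j ≤ 1` have degree `3 - 2 j` and the vectors killed by the products of `k` members of `t` have
degree `L k`. The degree `3 - 2 j` is twice the Kazhdan degree `2 - j` minus one, so that it drops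
under commutators. -/
inductive HasDegreeLE (φ : g →ₗ[K] A) (Γ : ℤ → Submodule K g) (t : ι → A) (L : ℤ) : ℤ → V → Prop
  | of_mem_annihilated (k : ℕ) (v : V) :
      v ∈ annihilated K V t k → HasDegreeLE φ Γ t L (L * k) v
  | zero (d : ℤ) : HasDegreeLE φ Γ t L d 0
  | add (d : ℤ) (v w : V) :
      HasDegreeLE φ Γ t L d v → HasDegreeLE φ Γ t L d w → HasDegreeLE φ Γ t L d (v + w)
  | smul (d : ℤ) (c : K) (v : V) : HasDegreeLE φ Γ t L d v → HasDegreeLE φ Γ t L d (c • v)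
  | mono (d d' : ℤ) (v : V) : d ≤ d' → HasDegreeLE φ Γ t L d v → HasDegreeLE φ Γ t L d' v
  | act (d j : ℤ) (a : g) (v : V) : j ≤ 1 → a ∈ Γ j → HasDegreeLE φ Γ t L d v →
      HasDegreeLE φ Γ t L (d + (3 - 2 * j)) (φ a • v)

variable (V) in
/-- The filtration of `HasDegreeLE` by subspaces. -/
def degreeLE (φ : g →ₗ[K] A) (Γ : ℤ → Submodule K g) (t : ι → A) (L d : ℤ) : Submodule K V where
  carrier := {v | HasDegreeLE φ Γ t L d v}
  zero_mem' := .zero d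
  add_mem' := .add d _ _
  smul_mem' := .smul d

variable {φ : g →ₗ[K] A} {Γ : ℤ → Submodule K g} {t : ι → A} {L : ℤ}

theorem degreeLE_mono : Monotone (degreeLE V φ Γ t L) :=
  fun _ _ hd _ hv => .mono _ _ _ hd hv

theorem annihilated_le_degreeLE (k : ℕ) : annihilated K V t k ≤ degreeLE V φ Γ t L (L * k) :=
  fun v hv => .of_mem_annihilated k v hv

theorem mem_opsLE_degreeLE {j : ℤ} (hj : j ≤ 1) {a : g} (ha : a ∈ Γ j) :
    φ a ∈ opsLE A (degreeLE V φ Γ t L) (3 - 2 * j) :=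
  fun _ _ hv => .act _ _ _ _ hj ha hv

theorem degreeLE_eq_bot (hL : 0 ≤ L) {d : ℤ} (hd : d < 0) : degreeLE V φ Γ t L d = ⊥ := by
  refine (Submodule.eq_bot_iff _).2 fun v (hv : HasDegreeLE φ Γ t L d v) => ?_
  induction hv with
  | of_mem_annihilated k => exact absurd hd (not_lt.2 (mul_nonneg hL k.cast_nonneg))
  | zero => rfl
  | add d v w _ _ ihv ihw => rw [ihv hd, ihw hd, add_zero]
  | smul d c v _ ih => rw [ih hd, smul_zero]
  | mono d d' _ hdd' _ ih => exact ih (by omega)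
  | act d j a v hj _ _ ih => rw [ih (by omega), smul_zero]

variable {χ : Module.Dual K g} {m : LieSubalgebra K g} [Finite ι] [DecidableEq ι]
  {x : Module.Basis ι K m} {z : ι → g} {n : ι → ℤ}

namespace IsDualFamily

theorem smul_mem_of_mem_annihilated (h : IsGradedCharacter Γ χ m) (hx : IsDualFamily Γ χ x z n)
    (hL : ∀ i, 2 * n i - 1 ≤ L) {k : ℕ} {v : V}
    (hv : v ∈ annihilated K V (fun i => shiftMap φ χ (x i)) k) {j : ℤ} {a : g} (ha : a ∈ m)
    (haj : a ∈ Γ j) : shiftMap φ χ a • v ∈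
      degreeLE V φ Γ (fun i => shiftMap φ χ (x i)) L (L * k + (1 - 2 * j)) := by
  cases k with
  | zero =>
    rw [(Submodule.mem_bot K).1 hv, smul_zero]
    exact zero_mem _
  | succ k =>
    refine smul_mem_of_mem_span (Set.forall_mem_image.2 fun i (hi : n i = j) => ?_)
      (hx.shiftMap_mem_span h ha haj)
    refine degreeLE_mono ?_ (annihilated_le_degreeLE k (mem_annihilated_succ.1 hv i))
    have := hL i
    push_cast
    linarith

theorem shiftMap_mem_opsLE (hφ : ∀ a b, φ ⁅a, b⁆ = ⁅φ a, φ b⁆) (h : IsGradedCharacter Γ χ m)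
    (hx : IsDualFamily Γ χ x z n) (hL : ∀ i, 2 * n i - 1 ≤ L) {j : ℤ} (hj : 1 ≤ j) {a : g}
    (ha : a ∈ m) (haj : a ∈ Γ j) :
    shiftMap φ χ a ∈
      opsLE A (degreeLE V φ Γ (fun i => shiftMap φ χ (x i)) L) (1 - 2 * j) := by
  intro d v (hv : HasDegreeLE _ _ _ _ d v)
  induction hv generalizing j a with
  | of_mem_annihilated k v hv => exact hx.smul_mem_of_mem_annihilated h hL hv ha haj
  | zero => rw [smul_zero]; exact zero_mem _
  | add d v w _ _ ihv ihw =>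
    rw [smul_add]
    exact add_mem (ihv hj ha haj) (ihw hj ha haj)
  | smul d c v _ ih =>
    rw [smul_comm]
    exact Submodule.smul_mem _ _ (ih hj ha haj)
  | mono d d' v hdd' _ ih => exact degreeLE_mono (by omega) (ih hj ha haj)
  | act d i b v hi hb hv ih =>
    have hab := h.lie_mem _ _ a haj b hb
    rw [smul_smul_eq_add_lie_smul, lie_shiftMap hφ]
    refine add_mem (smul_mem_of_mem_opsLE degreeLE_mono (mem_opsLE_degreeLE hi hb)
      (ih hj ha haj) (by omega)) ?_
    by_cases hij : j + i ≤ 1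
    · exact smul_mem_of_mem_opsLE degreeLE_mono (mem_opsLE_degreeLE hij hab) hv (by omega)
    have hm := h.grade_le _ (by omega) hab
    have hsplit : φ ⁅a, b⁆ • v = shiftMap φ χ ⁅a, b⁆ • v + χ ⁅a, b⁆ • v := by
      rw [shiftMap_apply, sub_smul, algebraMap_smul, sub_add_cancel]
    rw [hsplit]
    refine add_mem (degreeLE_mono (by omega) (ih (by omega) hm hab)) ?_
    by_cases h2 : j + i = 2
    · exact degreeLE_mono (by omega) (Submodule.smul_mem _ _ hv)
    · rw [h.char_eq_zero _ h2 _ hab, zero_smul]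
      exact zero_mem _

theorem isApproxHeisenberg (hφ : ∀ a b, φ ⁅a, b⁆ = ⁅φ a, φ b⁆) (h : IsGradedCharacter Γ χ m)
    (hx : IsDualFamily Γ χ x z n) (hL₀ : 0 ≤ L) (hL : ∀ i, 2 * n i - 1 ≤ L) :
    IsApproxHeisenberg (degreeLE V φ Γ (fun i => shiftMap φ χ (x i)) L)
      (fun i => shiftMap φ χ (x i)) (fun i => φ (z i)) (fun i => 2 * n i - 1) where
  toIsGradedFamily := hx.isGradedFamily hφ h
  mono := degreeLE_mono
  eq_bot _ hd := degreeLE_eq_bot hL₀ hd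
  t_mem i := opsLE_mono degreeLE_mono (by omega)
    (hx.shiftMap_mem_opsLE hφ h hL (hx.one_le i) (x i).2 (hx.x_mem i))
  z_mem i := opsLE_mono degreeLE_mono (by omega)
    (mem_opsLE_degreeLE (by have := hx.one_le i; omega) (hx.z_mem i))
  lie_z_mem i j := by
    have hij := h.lie_mem _ _ _ (hx.x_mem i) _ (hx.z_mem j)
    rw [lie_shiftMap hφ, ← hx.dual, ← shiftMap_apply]
    by_cases hle : n i + (2 - n j) ≤ 1
    · rw [shiftMap_eq_self (h.char_eq_zero _ (by omega) _ hij)]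
      exact opsLE_mono degreeLE_mono (by omega) (mem_opsLE_degreeLE hle hij)
    · exact opsLE_mono degreeLE_mono (by omega)
        (hx.shiftMap_mem_opsLE hφ h hL (by omega) (h.grade_le _ (by omega) hij) hij)

theorem exists_sub_eq_zero [CharZero K] (hφ : ∀ a b, φ ⁅a, b⁆ = ⁅φ a, φ b⁆)
    (h : IsGradedCharacter Γ χ m) (hx : IsDualFamily Γ χ x z n)
    (hV : LocNil (Set.range fun i => shiftMap φ χ (x i)) V) {P : Submodule A V} {v : V}
    (hv : ∀ i, shiftMap φ χ (x i) • v ∈ P) :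
    ∃ w ∈ P, ∀ i, shiftMap φ χ (x i) • (v - w) = 0 := by
  obtain ⟨L, hL⟩ := (Set.finite_range fun i => (2 * n i - 1).toNat).bddAbove
  obtain ⟨k, hk⟩ := (hx.isGradedFamily hφ h).exists_mem_annihilated hV v
  have hH := hx.isApproxHeisenberg (V := V) hφ h (Int.natCast_nonneg L) fun i =>
    Int.toNat_le.1 (hL ⟨i, rfl⟩)
  exact hH.exists_sub_eq_zero (d := L * k)
    (by simpa only [Nat.cast_mul] using annihilated_le_degreeLE k hk) hv

end IsDualFamily

end Kazhdan

section EnvelopingAlgebra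

variable {K g : Type*} [Field K] [LieRing g] [LieAlgebra K g]

attribute [local instance] LieRing.ofAssociativeRing in
variable (K g) in
/-- The canonical map `ι` from `g` to `U(g)` as a linear map. Unlike for the morphism of Lie
algebras `ι`, its type does not mention a Lie bracket on `U(g)`. -/
def ιLinear : g →ₗ[K] UniversalEnvelopingAlgebra K g :=
  (UniversalEnvelopingAlgebra.ι K : g →ₗ⁅K⁆ UniversalEnvelopingAlgebra K g).toLinearMap

attribute [local instance] LieRing.ofAssociativeRing in
theorem ιLinear_lie (a b : g) : ιLinear K g ⁅a, b⁆ = ⁅ιLinear K g a, ιLinear K g b⁆ :=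
  LieHom.map_lie (UniversalEnvelopingAlgebra.ι K) a b

theorem adjoin_range_ιLinear : Algebra.adjoin K (Set.range (ιLinear K g)) = ⊤ := by
  have h : (UniversalEnvelopingAlgebra.mkAlgHom K g).range = ⊤ :=
    (AlgHom.range_eq_top _).2 (RingCon.mkₐ_surjective _)
  rw [← h, ← Algebra.map_top, ← TensorAlgebra.adjoin_range_ι, AlgHom.map_adjoin, ← Set.range_comp]
  rfl

variable {χ : Module.Dual K g}

theorem iterate_lie_shiftMap (a b : g) (k : ℕ) :
    (fun y => ⁅shiftMap (ιLinear K g) χ a, y⁆)^[k] (ιLinear K g b) =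
      ιLinear K g ((LieAlgebra.ad K g a ^ k) b) := by
  induction k with
  | zero => rfl
  | succ k ih =>
    rw [Function.iterate_succ_apply', ih, lie_shiftMap ιLinear_lie, pow_succ', Module.End.mul_apply,
      LieAlgebra.ad_apply]

theorem smul_mem_nilVectors_shiftMap {V : Type*} [AddCommGroup V]
    [Module (UniversalEnvelopingAlgebra K g) V] {a : g} (ha : IsNilpotent (LieAlgebra.ad K g a))
    {v : V} (hv : v ∈ nilVectors (shiftMap (ιLinear K g) χ a) V)
    (y : UniversalEnvelopingAlgebra K g) :
    y • v ∈ nilVectors (shiftMap (ιLinear K g) χ a) V := by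
  have hy : y ∈ Algebra.adjoin K (Set.range (ιLinear K g)) :=
    adjoin_range_ιLinear (K := K) (g := g) ▸ Algebra.mem_top
  induction hy using Algebra.adjoin_induction generalizing v with
  | mem y hy =>
    obtain ⟨b, rfl⟩ := hy
    obtain ⟨k, hk⟩ := ha
    refine smul_mem_nilVectors (m := k) ?_ hv
    rw [iterate_lie_shiftMap, hk, LinearMap.zero_apply, map_zero]
  | algebraMap c =>
    refine smul_mem_nilVectors (m := 1) ?_ hv
    rw [Function.iterate_one, Ring.lie_def, Algebra.commutes, sub_self]
  | add x y _ _ hx hy => rw [add_smul]; exact add_mem (hx hv) (hy hv)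
  | mul x y _ _ hx hy => rw [mul_smul]; exact hx (hy hv)

end EnvelopingAlgebra

section Grading

variable {K g : Type*} [Field K] [LieRing g] [LieAlgebra K g]

/-- The sum of the components of degree at least `j`. -/
def gradeGE (Γ : ℤ → Submodule K g) (j : ℤ) : Submodule K g :=
  ⨆ (i : ℤ) (_ : j ≤ i), Γ i

variable {Γ : ℤ → Submodule K g}

theorem le_gradeGE {i j : ℤ} (hij : j ≤ i) : Γ i ≤ gradeGE Γ j :=
  le_iSup₂_of_le i hij le_rfl

theorem gradeGE_antitone : Antitone (gradeGE Γ) :=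
  fun _ _ hij => iSup₂_le fun _ hl => le_gradeGE (hij.trans hl)

theorem lie_mem_gradeGE (hΓ : ∀ i j, ∀ a ∈ Γ i, ∀ b ∈ Γ j, ⁅a, b⁆ ∈ Γ (i + j)) {i j : ℤ} {a b : g}
    (ha : a ∈ gradeGE Γ i) (hb : b ∈ gradeGE Γ j) : ⁅a, b⁆ ∈ gradeGE Γ (i + j) := by
  have hb' (i' : ℤ) (hi' : i ≤ i') (a : g) (ha : a ∈ Γ i') : ⁅a, b⁆ ∈ gradeGE Γ (i + j) := by
    suffices gradeGE Γ j ≤ (gradeGE Γ (i + j)).comap (LieAlgebra.ad K g a : g →ₗ[K] g) from this hb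
    exact iSup₂_le fun j' hj' b hb => le_gradeGE (add_le_add hi' hj') (hΓ _ _ _ ha _ hb)
  suffices gradeGE Γ i ≤ (gradeGE Γ (i + j)).comap (LieAlgebra.ad K g b : g →ₗ[K] g) by
    rw [← lie_skew]
    exact neg_mem (this ha)
  refine iSup₂_le fun i' hi' a ha => ?_
  rw [Submodule.mem_comap, LieAlgebra.ad_apply, ← lie_skew]
  exact neg_mem (hb' i' hi' a ha)

theorem exists_gradeGE_eq_top_and_eq_bot [FiniteDimensional K g] (hΓ : DirectSum.IsInternal Γ) :
    ∃ i j, gradeGE Γ i = ⊤ ∧ gradeGE Γ j = ⊥ := by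
  have hfin := WellFoundedGT.finite_ne_bot_of_iSupIndep hΓ.submodule_iSupIndep
  obtain ⟨i, hi⟩ := hfin.bddBelow
  obtain ⟨j, hj⟩ := hfin.bddAbove
  refine ⟨i, j + 1, ?_, ?_⟩
  · rw [eq_top_iff, ← hΓ.submodule_iSup_eq_top]
    refine iSup_le fun l => ?_
    by_cases hl : Γ l = ⊥
    · exact hl.trans_le bot_le
    · exact le_gradeGE (hi hl)
  · refine eq_bot_iff.2 (iSup₂_le fun l hl => ?_)
    by_contra hne
    have := hj fun h : Γ l = ⊥ => hne h.le
    omega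

theorem isNilpotent_ad_of_mem_gradeGE [FiniteDimensional K g] (hΓ : DirectSum.IsInternal Γ)
    (hlie : ∀ i j, ∀ a ∈ Γ i, ∀ b ∈ Γ j, ⁅a, b⁆ ∈ Γ (i + j)) {a : g} (ha : a ∈ gradeGE Γ 1) :
    IsNilpotent (LieAlgebra.ad K g a) := by
  obtain ⟨i, j, hi, hj⟩ := exists_gradeGE_eq_top_and_eq_bot hΓ
  have hk (k : ℕ) (b : g) : (LieAlgebra.ad K g a ^ k) b ∈ gradeGE Γ (i + k) := by
    induction k with
    | zero => simp [hi]
    | succ k ih =>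
      rw [pow_succ', Module.End.mul_apply, LieAlgebra.ad_apply, Nat.cast_succ, ← add_assoc,
        add_comm]
      exact lie_mem_gradeGE hlie ha ih
  refine ⟨(j - i).toNat, LinearMap.ext fun b => ?_⟩
  have := gradeGE_antitone (by omega : j ≤ i + (j - i).toNat) (hk _ b)
  rwa [hj, Submodule.mem_bot] at this

end Grading

section GoodGrading

variable {g : Type u} [LieRing g] [LieAlgebra ℂ g] {B : LinearMap.BilinForm ℂ g} {f q : g}
  {Γ : ℤ → Submodule ℂ g} {χ : Module.Dual ℂ g} {m : LieSubalgebra ℂ g}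

theorem bilin_eq_zero_of_add_ne_zero (hB : B.lieInvariant g) (hq : IsGradingElement q Γ) {i j : ℤ}
    (hij : i + j ≠ 0) {a b : g} (ha : a ∈ Γ i) (hb : b ∈ Γ j) : B a b = 0 := by
  have h := hB q a b
  rw [(hq i a).1 ha, (hq j b).1 hb, map_smul, map_smul, LinearMap.smul_apply, smul_eq_mul,
    smul_eq_mul, eq_neg_iff_add_eq_zero, ← add_mul] at h
  exact (mul_eq_zero.1 h).resolve_left (by exact_mod_cast hij)

theorem bilin_lie_right (hB : B.lieInvariant g) (f a b : g) : B f ⁅a, b⁆ = B ⁅f, a⁆ b := by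
  rw [← neg_neg (B f ⁅a, b⁆), ← hB, ← LinearMap.neg_apply, ← map_neg, lie_skew]

theorem IsGoodAlgebra.le_gradeGE (hm : IsGoodAlgebra Γ χ m) : m.toSubmodule ≤ gradeGE Γ 1 := by
  obtain ⟨l, hl, hml⟩ := hm
  exact hml.trans_le (sup_le (fun a ha => Stages.le_gradeGE le_rfl ((hl a).1 ha).1)
    (gradeGE_antitone one_le_two))

theorem IsGoodAlgebra.grade_le (hm : IsGoodAlgebra Γ χ m) {i : ℤ} (hi : 2 ≤ i) :
    Γ i ≤ m.toSubmodule := by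
  obtain ⟨l, -, hml⟩ := hm
  exact hml ▸ le_sup_of_le_right (Stages.le_gradeGE hi)

theorem IsGoodAlgebra.span_homogeneous (hm : IsGoodAlgebra Γ χ m) :
    Submodule.span ℂ {a : m | ∃ i, 1 ≤ i ∧ (a : g) ∈ Γ i} = ⊤ := by
  set s := {a : m | ∃ i, 1 ≤ i ∧ (a : g) ∈ Γ i}
  have hs {i : ℤ} (hi : 1 ≤ i) : Γ i ⊓ m.toSubmodule ≤
      (Submodule.span ℂ s).map m.toSubmodule.subtype :=
    fun a ha => ⟨⟨a, ha.2⟩, Submodule.subset_span ⟨i, hi, ha.1⟩, rfl⟩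
  have hle : m.toSubmodule ≤ (Submodule.span ℂ s).map m.toSubmodule.subtype := by
    obtain ⟨l, hl, hml⟩ := id hm
    refine hml.trans_le (sup_le (fun a ha => ?_) (iSup₂_le fun i hi a ha => ?_))
    · exact hs le_rfl ⟨((hl a).1 ha).1, hml ▸ Submodule.mem_sup_left ha⟩
    · exact hs (by omega) ⟨ha, hm.grade_le hi ha⟩
  refine eq_top_iff.2 fun a _ => ?_
  obtain ⟨b, hb, hba⟩ := hle a.2
  exact Subtype.ext hba ▸ hb

theorem IsGoodAlgebra.exists_homogeneous_basis [FiniteDimensional ℂ g]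
    (hm : IsGoodAlgebra Γ χ m) :
    ∃ (k : ℕ) (x : Module.Basis (Fin k) ℂ m), ∀ i, ∃ n, 1 ≤ n ∧ (x i : g) ∈ Γ n := by
  let b := Module.Basis.ofSpan hm.span_homogeneous.ge
  have := Module.Finite.finite_basis b
  refine ⟨_, b.reindex (Finite.equivFin _), fun i => ?_⟩
  rw [Module.Basis.reindex_apply]
  exact Module.Basis.ofSpan_subset hm.span_homogeneous.ge ⟨_, rfl⟩

theorem mem_shift_iff {t : UniversalEnvelopingAlgebra ℂ g} :
    t ∈ shift χ m ↔ ∃ a ∈ m, shiftMap (ιLinear ℂ g) χ a = t :=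
  ⟨fun ⟨a, ha⟩ => ⟨a.1, a.2, ha⟩, fun ⟨a, ha, hat⟩ => ⟨⟨a, ha⟩, hat⟩⟩

theorem shiftMap_mem_shift {a : g} (ha : a ∈ m) : shiftMap (ιLinear ℂ g) χ a ∈ shift χ m :=
  mem_shift_iff.2 ⟨a, ha, rfl⟩

theorem mem_whi_shift {V ι : Type*} [AddCommGroup V] [Module (UniversalEnvelopingAlgebra ℂ g) V]
    [Module ℂ V] [IsScalarTower ℂ (UniversalEnvelopingAlgebra ℂ g) V] (x : Module.Basis ι ℂ m)
    {v : V} (hv : ∀ i, shiftMap (ιLinear ℂ g) χ (x i) • v = 0) : v ∈ whi (shift χ m) V := by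
  intro t ht
  obtain ⟨a, ha, rfl⟩ := mem_shift_iff.1 ht
  let ψ : m →ₗ[ℂ] UniversalEnvelopingAlgebra ℂ g :=
    shiftMap (ιLinear ℂ g) χ ∘ₗ m.toSubmodule.subtype
  have hspan := Submodule.mem_map_of_mem (f := ψ) (x.mem_span ⟨a, ha⟩)
  rw [Submodule.map_span, ← Set.range_comp] at hspan
  exact (Submodule.mem_bot ℂ).1 (smul_mem_of_mem_span (Set.forall_mem_range.2 hv) hspan)

/-- A good algebra `m` for the linear form `B f`, where `B` is a nondegenerate invariant form and
the grading `Γ` is good for `f` and defined by `q`. -/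
structure IsGoodDatum (B : LinearMap.BilinForm ℂ g) (f q : g) (Γ : ℤ → Submodule ℂ g)
    (m : LieSubalgebra ℂ g) : Prop where
  invariant : B.lieInvariant g
  nondegenerate : B.Nondegenerate
  grading : IsGoodGrading Γ f
  element : IsGradingElement q Γ
  good : IsGoodAlgebra Γ (B f) m

namespace IsGoodDatum

theorem char_eq_zero (h : IsGoodDatum B f q Γ m) {i : ℤ} (hi : i ≠ 2) {a : g} (ha : a ∈ Γ i) :
    B f a = 0 :=
  bilin_eq_zero_of_add_ne_zero h.invariant h.element (by omega) h.grading.mem ha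

theorem char_lie (h : IsGoodDatum B f q Γ m) {a b : g} (ha : a ∈ m) (hb : b ∈ m) :
    B f ⁅a, b⁆ = 0 := by
  have hvanish {a b : g} {i j : ℤ} (hij : 3 ≤ i + j) (ha : a ∈ gradeGE Γ i)
      (hb : b ∈ gradeGE Γ j) : B f ⁅a, b⁆ = 0 := by
    have hker : gradeGE Γ 3 ≤ LinearMap.ker (B f) :=
      iSup₂_le fun i hi a ha => h.char_eq_zero (by omega) ha
    exact hker (gradeGE_antitone hij (lie_mem_gradeGE h.grading.lie_mem ha hb))
  have hb₁ := h.good.le_gradeGE hb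
  obtain ⟨l, hl, hml⟩ := h.good
  rw [← LieSubalgebra.mem_toSubmodule, hml] at ha hb
  obtain ⟨a₁, ha₁, a₂, ha₂, rfl⟩ := Submodule.mem_sup.1 ha
  obtain ⟨b₁, hb₁', b₂, hb₂, rfl⟩ := Submodule.mem_sup.1 hb
  have hl₁ {x : g} (hx : x ∈ l) : x ∈ gradeGE Γ 1 := le_gradeGE le_rfl ((hl x).1 hx).1
  rw [add_lie, lie_add, map_add, map_add, ((hl a₁).1 ha₁).2 b₁ hb₁',
    hvanish (by norm_num) (hl₁ ha₁) hb₂, hvanish (by norm_num) ha₂ hb₁, add_zero, add_zero]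

theorem isGradedCharacter (h : IsGoodDatum B f q Γ m) : IsGradedCharacter Γ (B f) m where
  lie_mem := h.grading.lie_mem
  grade_le _ hi := h.good.grade_le hi
  char_eq_zero _ hi _ ha := h.char_eq_zero hi ha
  char_lie _ ha _ hb := h.char_lie ha hb

theorem eq_zero_of_char_lie_eq_zero (h : IsGoodDatum B f q Γ m) {n : ℤ} (hn : 1 ≤ n) {a : g}
    (ha : a ∈ Γ n) (hχ : ∀ w ∈ Γ (2 - n), B f ⁅a, w⁆ = 0) : a = 0 := by
  refine h.grading.injective n hn a ha (h.nondegenerate.1 _ fun w => ?_)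
  have hfa := h.grading.lie_mem _ _ f h.grading.mem a ha
  have hker : ⨆ i, Γ i ≤ LinearMap.ker (B ⁅f, a⁆) := by
    refine iSup_le fun i w hw => ?_
    by_cases hi : i = 2 - n
    · exact (bilin_lie_right h.invariant f a w).symm.trans (hχ w (hi ▸ hw))
    · exact bilin_eq_zero_of_add_ne_zero h.invariant h.element (by omega) hfa hw
  exact hker (h.grading.isInternal.submodule_iSup_eq_top ▸ Submodule.mem_top)

theorem exists_char_lie_eq [FiniteDimensional ℂ g] (h : IsGoodDatum B f q Γ m) {n : ℤ}
    (hn : 1 ≤ n) (lam : Module.Dual ℂ g) : ∃ w ∈ Γ (2 - n), ∀ a ∈ Γ n, B f ⁅a, w⁆ = lam a := by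
  let pairing : Γ n →ₗ[ℂ] Γ (2 - n) →ₗ[ℂ] ℂ :=
    ((LieModule.toEnd ℂ g g : g →ₗ[ℂ] Module.End ℂ g).compr₂ (B f)).domRestrict₁₂ _ _
  have hinj : Function.Injective pairing := by
    refine (injective_iff_map_eq_zero _).2 fun a ha => Subtype.ext ?_
    exact h.eq_zero_of_char_lie_eq_zero hn a.2 fun w hw => LinearMap.congr_fun ha ⟨w, hw⟩
  obtain ⟨w, hw⟩ := LinearMap.flip_surjective_iff₁.2 hinj (lam ∘ₗ (Γ n).subtype)
  exact ⟨w, w.2, fun a ha => LinearMap.congr_fun hw ⟨a, ha⟩⟩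

theorem exists_isDualFamily [FiniteDimensional ℂ g] (h : IsGoodDatum B f q Γ m) :
    ∃ (k : ℕ) (x : Module.Basis (Fin k) ℂ m) (z : Fin k → g) (n : Fin k → ℤ),
      IsDualFamily Γ (B f) x z n := by
  obtain ⟨k, x, hx⟩ := h.good.exists_homogeneous_basis
  choose n hn hxn using hx
  choose lam hlam using fun i => LinearMap.exists_extend (p := m.toSubmodule) (x.coord i)
  choose z hz hχ using fun i => h.exists_char_lie_eq (hn i) (lam i)
  refine ⟨k, x, z, n, hn, hxn, hz, fun i j => ?_⟩
  by_cases hij : n i = n j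
  · rw [hχ j _ (hij ▸ hxn i)]
    refine (LinearMap.congr_fun (hlam j) (x i)).trans ?_
    rw [Module.Basis.coord_apply, Module.Basis.repr_self, Finsupp.single_apply]
  · rw [if_neg fun h => hij (congrArg n h),
      h.char_eq_zero (by omega) (h.grading.lie_mem _ _ _ (hxn i) _ (hz j))]

theorem char_eq_of_mem {f' : g} (h : IsGoodDatum B f q Γ m) (hf : f' - f ∈ Γ 0) {a : g}
    (ha : a ∈ m) : B f' a = B f a := by
  have hker : gradeGE Γ 1 ≤ LinearMap.ker (B (f' - f)) := iSup₂_le fun i hi a ha =>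
    bilin_eq_zero_of_add_ne_zero h.invariant h.element (by omega) hf ha
  have := LinearMap.mem_ker.1 (hker (h.good.le_gradeGE ha))
  rwa [map_sub, LinearMap.sub_apply, sub_eq_zero] at this

variable {f₁ f₂ q₁ q₂ : g} {Γ₁ Γ₂ : ℤ → Submodule ℂ g} {m₁ m₂ m₀ : LieSubalgebra ℂ g}

theorem ι_mem_normalizer (h₁ : IsGoodDatum B f₁ q₁ Γ₁ m₁) (h₂ : IsGoodDatum B f₂ q₂ Γ₂ m₂)
    (hm : m₁.toSubmodule ≤ m₂.toSubmodule) (hideal : ∀ x ∈ m₂, ∀ y ∈ m₁, ⁅x, y⁆ ∈ m₁)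
    (hf : f₂ - f₁ ∈ Γ₁ 0) {y : g} (hy : y ∈ m₂) :
    UniversalEnvelopingAlgebra.ι ℂ y ∈ normalizer ℂ (shift (B f₁) m₁) := by
  intro t ht
  obtain ⟨a, ha, rfl⟩ := mem_shift_iff.1 ht
  have hay : ⁅a, y⁆ ∈ m₁ := by
    rw [← lie_skew]
    exact neg_mem (hideal y hy a ha)
  have hχ : B f₁ ⁅a, y⁆ = 0 := by rw [← h₁.char_eq_of_mem hf hay, h₂.char_lie (hm ha) hy]
  have hlie : ⁅shiftMap (ιLinear ℂ g) (B f₁) a, ιLinear ℂ g y⁆ =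
      shiftMap (ιLinear ℂ g) (B f₁) ⁅a, y⁆ := by
    rw [lie_shiftMap ιLinear_lie, shiftMap_eq_self hχ]
  exact hlie.symm ▸ Ideal.subset_span (shiftMap_mem_shift hay)

variable [FiniteDimensional ℂ g]

theorem smul_mem_nilVectors (h : IsGoodDatum B f q Γ m) {V : Type*} [AddCommGroup V]
    [Module (UniversalEnvelopingAlgebra ℂ g) V] {t : UniversalEnvelopingAlgebra ℂ g}
    (ht : t ∈ shift (B f) m) {v : V} (hv : v ∈ nilVectors t V)
    (y : UniversalEnvelopingAlgebra ℂ g) : y • v ∈ nilVectors t V := by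
  obtain ⟨a, ha, rfl⟩ := mem_shift_iff.1 ht
  exact smul_mem_nilVectors_shiftMap (isNilpotent_ad_of_mem_gradeGE h.grading.isInternal
    h.grading.lie_mem (h.good.le_gradeGE ha)) hv y

theorem locNil_Q (h : IsGoodDatum B f q Γ m) : LocNil (shift (B f) m) (Q (shift (B f) m)) := by
  intro t ht v
  obtain ⟨y, rfl⟩ := Submodule.Quotient.mk_surjective _ v
  rw [← mul_one y, ← smul_eq_mul, Submodule.Quotient.mk_smul]
  exact h.smul_mem_nilVectors ht ⟨1, by rw [pow_one]; exact one_mem_whi t ht⟩ y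

theorem isProjectiveGenerator (h : IsGoodDatum B f q Γ m) :
    IsProjectiveGenerator (shift (B f) m) := by
  obtain ⟨k, x, z, n, hx⟩ := h.exists_isDualFamily
  refine ⟨h.locNil_Q, fun V _ _ hV P v hv => ?_, fun V _ _ hV hwhi v => ?_⟩
  all_goals
    let _ : Module ℂ V := Module.compHom V (algebraMap ℂ (UniversalEnvelopingAlgebra ℂ g))
    have : IsScalarTower ℂ (UniversalEnvelopingAlgebra ℂ g) V := IsScalarTower.of_compHom ..
    have hVx : LocNil (Set.range fun i => shiftMap (ιLinear ℂ g) (B f) (x i)) V :=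
      hV.mono (Set.range_subset_iff.2 fun i => shiftMap_mem_shift (x i).2)
  · obtain ⟨w, hw, hvw⟩ := hx.exists_sub_eq_zero ιLinear_lie h.isGradedCharacter hVx fun i =>
      hv _ (shiftMap_mem_shift (x i).2)
    exact ⟨w, hw, mem_whi_shift x hvw⟩
  · by_contra hv
    obtain ⟨w, hw₀, hw⟩ :=
      (hx.isGradedFamily ιLinear_lie h.isGradedCharacter).exists_ne_zero hVx hv
    exact hw₀ (hwhi w (mem_whi_shift x hw))

theorem isTwoStage (h₁ : IsGoodDatum B f₁ q₁ Γ₁ m₁) (h₂ : IsGoodDatum B f₂ q₂ Γ₂ m₂)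
    (hsum : m₁.toSubmodule ⊔ m₀.toSubmodule = m₂.toSubmodule)
    (hideal : ∀ x ∈ m₂, ∀ y ∈ m₁, ⁅x, y⁆ ∈ m₁) (hf : f₂ - f₁ ∈ Γ₁ 0)
    (hemb : ∀ y ∈ m₀, UniversalEnvelopingAlgebra.ι ℂ y ∈ normalizer ℂ (shift (B f₁) m₁)) :
    IsTwoStage ℂ (shift (B f₁) m₁) (shift (B f₂) m₂) (shift₀ (B f₁) m₁ (B f₂) m₀ hemb) := by
  have hm₁ : m₁.toSubmodule ≤ m₂.toSubmodule := hsum ▸ le_sup_left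
  have hm₀ : m₀.toSubmodule ≤ m₂.toSubmodule := hsum ▸ le_sup_right
  have hshift {a : g} (ha : a ∈ m₁) :
      shiftMap (ιLinear ℂ g) (B f₁) a = shiftMap (ιLinear ℂ g) (B f₂) a := by
    rw [shiftMap_apply, shiftMap_apply, h₁.char_eq_of_mem hf ha]
  have hnorm (t) (ht : t ∈ shift (B f₂) m₂) : t ∈ normalizer ℂ (shift (B f₁) m₁) := by
    obtain ⟨a, ha, rfl⟩ := mem_shift_iff.1 ht
    rw [shiftMap_apply]
    exact sub_mem (h₁.ι_mem_normalizer h₂ hm₁ hideal hf ha) (algebraMap_mem _ _)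
  refine ⟨h₁.isProjectiveGenerator, h₂.isProjectiveGenerator,
    fun V _ _ t ht v hv y => h₂.smul_mem_nilVectors ht hv y, fun t ht => ?_, hnorm,
    fun x => ⟨?_, ?_⟩⟩
  · obtain ⟨a, ha, rfl⟩ := mem_shift_iff.1 ht
    exact hshift ha ▸ shiftMap_mem_shift (hm₁ ha)
  · rintro ⟨y, rfl⟩
    exact ⟨_, shiftMap_mem_shift (hm₀ y.2), rfl⟩
  · rintro ⟨t, ht, rfl⟩
    obtain ⟨a, ha, rfl⟩ := mem_shift_iff.1 ht
    rw [← LieSubalgebra.mem_toSubmodule, ← hsum] at ha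
    obtain ⟨a₁, ha₁, a₀, ha₀, rfl⟩ := Submodule.mem_sup.1 ha
    refine ⟨⟨a₀, ha₀⟩, cls_eq_cls_iff (hX := hnorm _ (shiftMap_mem_shift (hm₀ ha₀))).2 ?_⟩
    rw [map_add, sub_add_cancel_right, ← hshift ha₁]
    exact neg_mem (Ideal.subset_span (shiftMap_mem_shift ha₁))

end IsGoodDatum

end GoodGrading

end Stages

end

theorem theorem4p2_general {g : Type u} [LieRing g] [LieAlgebra ℂ g] [FiniteDimensional ℂ g]
    (B : LinearMap.BilinForm ℂ g) (hBinv : B.lieInvariant g)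
    (hBnondeg : B.Nondegenerate)
    (f₁ f₂ : g)
    (Γ₁ Γ₂ : ℤ → Submodule ℂ g)
    (hΓ₁ : Stages.IsGoodGrading Γ₁ f₁) (hΓ₂ : Stages.IsGoodGrading Γ₂ f₂)
    (q₁ q₂ : g)
    (hq₁ : Stages.IsGradingElement q₁ Γ₁) (hq₂ : Stages.IsGradingElement q₂ Γ₂)
    (m₁ m₂ m₀ : LieSubalgebra ℂ g)
    (hm₁ : Stages.IsGoodAlgebra Γ₁ (B f₁) m₁) (hm₂ : Stages.IsGoodAlgebra Γ₂ (B f₂) m₂)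
    (hsum : m₁.toSubmodule ⊔ m₀.toSubmodule = m₂.toSubmodule)
    (hideal : ∀ x ∈ m₂, ∀ y ∈ m₁, ⁅x, y⁆ ∈ m₁)
    (hf₀ : f₂ - f₁ ∈ Γ₁ 0) :
    ∃ (hemb : ∀ y ∈ m₀, UniversalEnvelopingAlgebra.ι ℂ y ∈
          Stages.normalizer ℂ (Stages.shift (B f₁) m₁))
      (Ψ : Stages.Reduction ℂ (Stages.shift₀ (B f₁) m₁ (B f₂) m₀ hemb) ≃ₐ[ℂ]
          Stages.FiniteW (B f₂) m₂),
      (∀ (X : UniversalEnvelopingAlgebra ℂ g)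
          (h₁ : X ∈ Stages.normalizer ℂ (Stages.shift (B f₁) m₁))
          (h₀ : Stages.cls ℂ (Stages.shift (B f₁) m₁) X h₁ ∈
            Stages.normalizer ℂ (Stages.shift₀ (B f₁) m₁ (B f₂) m₀ hemb)),
        ∃ h₂ : X ∈ Stages.normalizer ℂ (Stages.shift (B f₂) m₂),
          Ψ (Stages.cls ℂ (Stages.shift₀ (B f₁) m₁ (B f₂) m₀ hemb)
              (Stages.cls ℂ (Stages.shift (B f₁) m₁) X h₁) h₀) =
            Stages.cls ℂ (Stages.shift (B f₂) m₂) X h₂) ∧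
      Stages.RestrictToEquivalence
        (Stages.WhiVia (Stages.shift₀ (B f₁) m₁ (B f₂) m₀ hemb) Ψ)
        (Stages.IndVia (Stages.shift₀ (B f₁) m₁ (B f₂) m₀ hemb) Ψ)
        (Stages.whittaker (Stages.shift₀ (B f₁) m₁ (B f₂) m₀ hemb))
        (Stages.finitelyGenerated (Stages.FiniteW (B f₂) m₂)) ∧
      Stages.WhittakerModules (B f₂) m₂ ≤ Stages.WhittakerModules (B f₁) m₁ ∧
      Stages.RestrictToEquivalence
        (Stages.Whi ℂ (Stages.shift (B f₁) m₁))
        (Stages.Ind ℂ (Stages.shift (B f₁) m₁))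
        (Stages.WhittakerModules (B f₂) m₂)
        (Stages.whittaker (Stages.shift₀ (B f₁) m₁ (B f₂) m₀ hemb)) ∧
      ∃ α : (Stages.WhittakerModules (B f₂) m₂).ι ⋙ Stages.Whi ℂ (Stages.shift (B f₁) m₁) ⋙
            Stages.WhiVia (Stages.shift₀ (B f₁) m₁ (B f₂) m₀ hemb) Ψ ≅
          (Stages.WhittakerModules (B f₂) m₂).ι ⋙ Stages.Whi ℂ (Stages.shift (B f₂) m₂),
        ∀ (V : (Stages.WhittakerModules (B f₂) m₂).FullSubcategory)
          (v : Stages.whi (Stages.shift₀ (B f₁) m₁ (B f₂) m₀ hemb)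
            (Stages.whi (Stages.shift (B f₁) m₁) V.obj)),
          (Stages.whi (Stages.shift (B f₂) m₂) V.obj).subtype ((α.hom.app V).hom v) =
            ((v : Stages.whi (Stages.shift (B f₁) m₁) V.obj) : V.obj) := by
  have h₁ : Stages.IsGoodDatum B f₁ q₁ Γ₁ m₁ := ⟨hBinv, hBnondeg, hΓ₁, hq₁, hm₁⟩
  have h₂ : Stages.IsGoodDatum B f₂ q₂ Γ₂ m₂ := ⟨hBinv, hBnondeg, hΓ₂, hq₂, hm₂⟩
  have hemb := fun y (hy : y ∈ m₀) => h₁.ι_mem_normalizer h₂ (hsum ▸ le_sup_left) hideal hf₀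
    ((le_sup_right.trans hsum.le : m₀.toSubmodule ≤ m₂.toSubmodule) hy)
  have h := h₁.isTwoStage h₂ hsum hideal hf₀ hemb
  exact ⟨hemb, h.reductionEquiv,
    fun X k₁ k₀ => ⟨(h.cls_mem_normalizer_iff k₁).1 k₀, h.reductionEquiv_cls k₁ k₀⟩,
    h.gen₀.restrictToEquivalence_via h.reductionEquiv, h.whittaker_le, h.restrictToEquivalence₁,
    h.whiWhiIso, h.whiWhiIso_apply⟩

theorem theorem4p2 {g : Type u} [LieRing g] [LieAlgebra ℂ g] [FiniteDimensional ℂ g]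
    [LieAlgebra.IsSimple ℂ g]
    (B : LinearMap.BilinForm ℂ g) (hBsymm : B.IsSymm) (hBinv : B.lieInvariant g)
    (hBnondeg : B.Nondegenerate)
    (f₁ f₂ : g) (hf₁ : IsNilpotent (LieAlgebra.ad ℂ g f₁))
    (hf₂ : IsNilpotent (LieAlgebra.ad ℂ g f₂))
    (Γ₁ Γ₂ : ℤ → Submodule ℂ g)
    (hΓ₁ : Stages.IsGoodGrading Γ₁ f₁) (hΓ₂ : Stages.IsGoodGrading Γ₂ f₂)
    (q₁ q₂ : g)
    (hq₁ : Stages.IsGradingElement q₁ Γ₁) (hq₂ : Stages.IsGradingElement q₂ Γ₂)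
    (H : LieSubalgebra ℂ g) (hH : H.IsCartanSubalgebra) (hq₁H : q₁ ∈ H) (hq₂H : q₂ ∈ H)
    (m₁ m₂ m₀ : LieSubalgebra ℂ g)
    (hm₁ : Stages.IsGoodAlgebra Γ₁ (B f₁) m₁) (hm₂ : Stages.IsGoodAlgebra Γ₂ (B f₂) m₂)
    (hsum : m₁.toSubmodule ⊔ m₀.toSubmodule = m₂.toSubmodule)
    (hdisj : Disjoint m₁.toSubmodule m₀.toSubmodule)
    (hm₀H : ∀ x ∈ H, ∀ y ∈ m₀, ⁅x, y⁆ ∈ m₀)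
    (hideal : ∀ x ∈ m₂, ∀ y ∈ m₁, ⁅x, y⁆ ∈ m₁)
    (hf₀ : f₂ - f₁ ∈ Γ₁ 0) (hm₀ : m₀.toSubmodule ≤ Γ₁ 0)
    (hq₀ : ⁅q₂ - q₁, f₁⁆ = 0) :
    -- `m₀` maps to `U(g, f₁)` by `y ↦ y mod Î₁`, and `Ψ` identifies `U₀` with `U(g, f₂)` by
    -- `(X mod Î₁) mod Î₀ ↦ X mod Î₂`
    ∃ (hemb : ∀ y ∈ m₀, UniversalEnvelopingAlgebra.ι ℂ y ∈
          Stages.normalizer ℂ (Stages.shift (B f₁) m₁))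
      (Ψ : Stages.Reduction ℂ (Stages.shift₀ (B f₁) m₁ (B f₂) m₀ hemb) ≃ₐ[ℂ]
          Stages.FiniteW (B f₂) m₂),
      (∀ (X : UniversalEnvelopingAlgebra ℂ g)
          (h₁ : X ∈ Stages.normalizer ℂ (Stages.shift (B f₁) m₁))
          (h₀ : Stages.cls ℂ (Stages.shift (B f₁) m₁) X h₁ ∈
            Stages.normalizer ℂ (Stages.shift₀ (B f₁) m₁ (B f₂) m₀ hemb)),
        ∃ h₂ : X ∈ Stages.normalizer ℂ (Stages.shift (B f₂) m₂),
          Ψ (Stages.cls ℂ (Stages.shift₀ (B f₁) m₁ (B f₂) m₀ hemb)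
              (Stages.cls ℂ (Stages.shift (B f₁) m₁) X h₁) h₀) =
            Stages.cls ℂ (Stages.shift (B f₂) m₂) X h₂) ∧
      -- `Whi₀` and `Ind₀` are mutually inverse equivalences between `W₀` and `U(g, f₂)`-mod
      Stages.RestrictToEquivalence
        (Stages.WhiVia (Stages.shift₀ (B f₁) m₁ (B f₂) m₀ hemb) Ψ)
        (Stages.IndVia (Stages.shift₀ (B f₁) m₁ (B f₂) m₀ hemb) Ψ)
        (Stages.whittaker (Stages.shift₀ (B f₁) m₁ (B f₂) m₀ hemb))
        (Stages.finitelyGenerated (Stages.FiniteW (B f₂) m₂)) ∧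
      -- `W(g, f₂, m₂)` is contained in `W(g, f₁, m₁)`, and `Whi₁` and `Ind₁` restrict to
      -- mutually inverse equivalences between `W(g, f₂, m₂)` and `W₀`
      Stages.WhittakerModules (B f₂) m₂ ≤ Stages.WhittakerModules (B f₁) m₁ ∧
      Stages.RestrictToEquivalence
        (Stages.Whi ℂ (Stages.shift (B f₁) m₁))
        (Stages.Ind ℂ (Stages.shift (B f₁) m₁))
        (Stages.WhittakerModules (B f₂) m₂)
        (Stages.whittaker (Stages.shift₀ (B f₁) m₁ (B f₂) m₀ hemb)) ∧
      -- `Whi₂ = Whi₀ ∘ Whi₁` on `W(g, f₂, m₂)`: a natural isomorphism of `U(g, f₂)`-modules which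
      -- is the identity on the underlying vectors of `V`
      ∃ α : (Stages.WhittakerModules (B f₂) m₂).ι ⋙ Stages.Whi ℂ (Stages.shift (B f₁) m₁) ⋙
            Stages.WhiVia (Stages.shift₀ (B f₁) m₁ (B f₂) m₀ hemb) Ψ ≅
          (Stages.WhittakerModules (B f₂) m₂).ι ⋙ Stages.Whi ℂ (Stages.shift (B f₂) m₂),
        ∀ (V : (Stages.WhittakerModules (B f₂) m₂).FullSubcategory)
          (v : Stages.whi (Stages.shift₀ (B f₁) m₁ (B f₂) m₀ hemb)
            (Stages.whi (Stages.shift (B f₁) m₁) V.obj)),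
          (Stages.whi (Stages.shift (B f₂) m₂) V.obj).subtype ((α.hom.app V).hom v) =
            ((v : Stages.whi (Stages.shift (B f₁) m₁) V.obj) : V.obj) := by
  exact theorem4p2_general B hBinv hBnondeg f₁ f₂ Γ₁ Γ₂ hΓ₁ hΓ₂ q₁ q₂ hq₁ hq₂ m₁ m₂ m₀ hm₁ hm₂
    hsum hideal hf₀
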